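/- Let $N>1$, $a\ge 1$, $b\ge 1$ be integers and let $\alpha\in(0,1]$. On a probability space $(\Omega,\mathcal A,P)$ consider $N$ interacting two-colour Pólya urns with mean-field interaction: at time $0$ each urn contains $a$ red and $b$ black balls; at each time $t+1$ ($t\ge 0$) one ball, red or black, is added to each urn. Let $I_{k}(i)$ be the indicator of the event that the ball added to urn $i$ at time $k\ge1$ is red, let $\mathcal F_0=\{\emptyset,\Omega\}$ and $\mathcal F_t=\sigma(I_k(i): 1\le i\le N,\ 1\le k\le t)$, let $Z_t(i)=\frac{a+\sum_{k=1}^t I_k(i)}{a+b+t}$ be the proportion of red balls in urn $i$ at time $t$ and $Z_t=\frac1N\sum_{i=1}^N Z_t(i)$ the total proportion. Conditionally on $\mathcal F_t$, the colours of the $N$ balls added at time $t+1$ are independent, and the ball added to urn $j$ is red with conditional probability $\alpha Z_t+(1-\alpha)Z_t(j)$. Then $Z_t$ converges almost surely to a random variable $Z$, and $$\sqrt t\,(Z_t-Z)\longrightarrow \mathcal N\Bigl(0,\tfrac1N(Z-Z^2)\Bigr)\quad\text{stably},$$ that is, for every $H\in\mathcal A$ with $P(H)>0$, the conditional law $P(\sqrt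 t\,(Z_t-Z)\in\cdot\mid H)$ converges weakly to $E[K(\cdot)\mid H]$, where $K(\omega)=\mathcal N\bigl(0,\tfrac1N(Z(\omega)-Z(\omega)^2)\bigr)$ (and $\mathcal N(0,0)$ is the Dirac mass at $0$). The convergence also holds in the sense of almost sure conditional convergence with respect to $(\mathcal F_t)_t$: if $K_t$ is a version of the conditional distribution of $\sqrt t\,(Z_t-Z)$ given $\mathcal F_t$, then, for almost every $\omega$, the probability measure $K_t(\omega)$ converges weakly to $K(\omega)$. -/

import Mathlib

open MeasureTheory ProbabilityTheory Filter Topology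
open scoped NNReal BoundedContinuousFunction

noncomputable section

/-! ### Weak, stable and almost sure conditional convergence -/

section Convergence

variable {Ω S : Type*} [mΩ : MeasurableSpace Ω]
  [TopologicalSpace S] [PolishSpace S] [mS : MeasurableSpace S] [BorelSpace S]

/-- Weak convergence of a sequence of probability measures on `S`, through bounded continuous
real test functions. -/
def WeaklyConverges (ν : ℕ → Measure S) (ν' : Measure S) : Prop :=
  (∀ t, IsProbabilityMeasure (ν t)) ∧ IsProbabilityMeasure ν' ∧
    ∀ f : S →ᵇ ℝ, Tendsto (fun t => ∫ x, f x ∂(ν t)) atTop (𝓝 (∫ x, f x ∂ν'))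

/-- Stable convergence of the `S`-valued random variables `Y t` to the kernel `K`: for every event
`H` of positive probability, the conditional law `P(Y t ∈ · | H)` converges weakly to
`E[K(·) | H]`, which is the mixture of the measures `K ω` under `P(· | H)`. -/
def StablyConverges (μ : Measure Ω) (Y : ℕ → Ω → S) (K : Kernel Ω S) : Prop :=
  (∀ t, Measurable (Y t)) ∧
    ∀ H : Set Ω, MeasurableSet H → μ H ≠ 0 →
      WeaklyConverges (fun t => (cond μ H).map (Y t)) ((cond μ H).bind K)

/-- `κ` is a version of the (regular) conditional distribution of `X` given the sub-σ-field `m`: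
an `m`-measurable family of probability measures on `S` with `κ(·)(B) = P(X ∈ B | m)` almost surely
for each Borel set `B`. -/
structure IsCondDistribVersion (μ : Measure Ω) (m : MeasurableSpace Ω) (X : Ω → S)
    (κ : @Kernel Ω S m mS) : Prop where
  isProbabilityMeasure : ∀ ω, IsProbabilityMeasure (κ ω)
  ae_eq : ∀ B : Set S, MeasurableSet B →
    (fun ω => (κ ω).real B) =ᵐ[μ] μ[(X ⁻¹' B).indicator (fun _ => (1 : ℝ)) | m]

/-- Almost sure conditional convergence of `Y t` to the kernel `K` with respect to the sequence of
sub-σ-fields `G t`: versions of the conditional distributions of `Y t` given `G t` exist and,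
whichever versions `κ t` are taken, for almost every `ω` the measures `κ t ω` converge weakly
to `K ω`. -/
def ASConditionallyConverges (μ : Measure Ω) (G : ℕ → MeasurableSpace Ω) (Y : ℕ → Ω → S)
    (K : Kernel Ω S) : Prop :=
  (∀ t, G t ≤ mΩ) ∧ (∀ t, Measurable (Y t)) ∧
    (∀ t, ∃ κ : @Kernel Ω S (G t) mS, IsCondDistribVersion μ (G t) (Y t) κ) ∧
    ∀ κ : ∀ t, @Kernel Ω S (G t) mS, (∀ t, IsCondDistribVersion μ (G t) (Y t) (κ t)) →
      ∀ᵐ ω ∂μ, WeaklyConverges (fun t => κ t ω) (K ω)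

end Convergence

/-! ### The centred Gaussian kernel with random variance -/

section GaussianKernel

variable {Ω : Type*} [MeasurableSpace Ω]

/-- The kernel `ω ↦ 𝒩(0, w ω)` with random variance `w`; `𝒩(0, 0)` is the Dirac mass at `0`.
A negative value of `w` is read as `0`. -/
def gaussianKernel (w : Ω → ℝ) (hw : Measurable w) : Kernel Ω ℝ where
  toFun ω := gaussianReal 0 (Real.toNNReal (w ω))
  measurable' := measurable_gaussianReal.comp (measurable_const.prodMk hw.real_toNNReal)

end GaussianKernel

/-! ### Pólya urns with mean-field interaction -/

namespace PolyaUrns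

variable {Ω : Type*} {N : ℕ}

/-- The proportion of red balls in urn `j` at time `t`, when each urn starts with `a` red and `b`
black balls and `red k i` is the event that the ball added in urn `i` at time `k + 1` is red. -/
def frac (a b : ℕ) (red : ℕ → Fin N → Set Ω) (t : ℕ) (j : Fin N) (ω : Ω) : ℝ :=
  ((a : ℝ) + ∑ k ∈ Finset.range t, (red k j).indicator (fun _ => (1 : ℝ)) ω) /
    ((a : ℝ) + (b : ℝ) + (t : ℝ))

/-- The total proportion of red balls in the system at time `t`. -/
def total (a b : ℕ) (red : ℕ → Fin N → Set Ω) (t : ℕ) (ω : Ω) : ℝ :=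
  (1 / (N : ℝ)) * ∑ i, frac a b red t i ω

/-- The σ-field generated by the colours of the balls added up to time `t` (trivial for
`t = 0`). -/
@[reducible]
def history (red : ℕ → Fin N → Set Ω) (t : ℕ) : MeasurableSpace Ω :=
  MeasurableSpace.generateFrom {s | ∃ k < t, ∃ i, s = red k i}

/-- The system of `N` Pólya urns with mean-field interaction of strength `α`: given the past up to
time `t`, the ball added in urn `j` at time `t + 1` is red with conditional probability
`α Z_t + (1 - α) Z_t(j)`, and the colours of the balls added in the different urns at time `t + 1`
are conditionally independent. -/
structure IsMeanField [MeasurableSpace Ω] (μ : Measure Ω) (a b : ℕ) (α : ℝ)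
    (red : ℕ → Fin N → Set Ω) : Prop where
  measurableSet_red : ∀ t i, MeasurableSet (red t i)
  condProb_red : ∀ t j,
    μ[(red t j).indicator (fun _ => (1 : ℝ)) | history red t] =ᵐ[μ]
      fun ω => α * total a b red t ω + (1 - α) * frac a b red t j ω
  condIndep_red : ∀ (t : ℕ) (J : Finset (Fin N)),
    μ[(⋂ j ∈ J, red t j).indicator (fun _ => (1 : ℝ)) | history red t] =ᵐ[μ]
      fun ω => ∏ j ∈ J, (μ[(red t j).indicator (fun _ => (1 : ℝ)) | history red t]) ω

end PolyaUrns

end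

/-! The total proportion `M n` is a bounded martingale, since the average over the urns of the
conditional probabilities of red is the total proportion itself. Its increments are of order `1 /
t`, and by conditional independence their conditional variances are `V t / (c + t + 1) ^ 2` with `V
t = N⁻² ∑ p_i (1 - p_i)`. Hence `M` converges to some `Z`. The squared gap between one urn and the
mean contracts on average at rate `2α / t` up to errors of order `t⁻²`, so it vanishes
(`tendsto_zero_of_condExp_succ_le`). All `p_i` then tend to `Z`, and `V` tends to `(Z - Z²) / N`.

The rest concerns such "slow" martingales in general. Given `ℱ n`, the deviation `√n (M n - Z)` is a
sum of small martingale increments of total variance about `n V n ∑_{k ≥ n} (c + k)⁻²`, that is,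
about `V n`. Lindeberg replacement, one increment at a time, compares its conditional characteristic
function with `exp (-u² V n / 2)`. The error is `O(n^{-1/2})` plus the conditional expectation of
the oscillation of `V` after time `n`, which vanishes by Hunt's lemma (`tendsto_condExp_tailOsc`).
This yields `tendsto_condExp_cos`.

Almost sure statements are available for countably many frequencies only. A uniform bound on
conditional first moments makes the characteristic functions equi-Lipschitz, so rational frequencies
suffice for almost sure conditional convergence. Stable convergence follows from it, because the
deviations are measurable, up to null sets, with respect to the limit σ-field
(`tendsto_setIntegral_of_tendsto_condExp`). -/

/-! ### Taylor bounds for one Lindeberg replacement -/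

section Analysis

/-- For `|h| ≤ 1` this is a Taylor bound; for `|h| ≥ 1` every term is dominated by `|h| ^ 3`. The
constant is not sharp, but no restriction on `h` remains. -/
lemma abs_cos_sub_le_cube (h : ℝ) : |Real.cos h - (1 - h ^ 2 / 2)| ≤ 3 * |h| ^ 3 := by
  have h0 := abs_nonneg h
  rcases le_total |h| 1 with h1 | h1
  · refine (Real.cos_bound h1).trans ?_
    have : |h| ^ 4 ≤ |h| ^ 3 := pow_le_pow_of_le_one h0 h1 (by norm_num)
    have : 0 ≤ |h| ^ 3 := by positivity
    linarith
  · have h2 : |h| ^ 2 ≤ |h| ^ 3 := pow_le_pow_right₀ h1 (by norm_num)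
    have h3 : 1 ≤ |h| ^ 3 := one_le_pow₀ h1
    have h4 := Real.cos_le_one h
    have h5 := Real.neg_one_le_cos h
    have h6 : 0 ≤ h ^ 2 := sq_nonneg h
    rw [sq_abs] at h2
    rw [abs_le]
    constructor <;> linarith

lemma abs_sin_sub_le_cube (h : ℝ) : |Real.sin h - h| ≤ 2 * |h| ^ 3 := by
  have h0 := abs_nonneg h
  rcases le_total |h| 1 with h1 | h1
  · have h2 := abs_le.1 (Real.sin_bound h1)
    have : |h| ^ 5 ≤ |h| ^ 3 := pow_le_pow_of_le_one h0 h1 (by norm_num)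
    have h3 : 0 ≤ |h| ^ 3 := by positivity
    have h4 := abs_le.1 (abs_pow h 3).le
    rw [abs_le]
    constructor <;> linarith [h2.1, h2.2, h4.1, h4.2]
  · have h2 : |h| ≤ |h| ^ 3 := le_self_pow₀ h1 (by norm_num)
    calc |Real.sin h - h| ≤ |Real.sin h| + |h| := norm_sub_le (Real.sin h) h
      _ ≤ |h| + |h| := by gcongr ?_ + _; exact Real.abs_sin_le_abs
      _ ≤ 2 * |h| ^ 3 := by linarith

lemma abs_exp_neg_sub_le_sq {c : ℝ} (hc : 0 ≤ c) : |Real.exp (-c) - (1 - c)| ≤ c ^ 2 := by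
  -- The upper half comes from `exp (-c) ≤ 1 / (1 + c) ≤ 1 - c + c ^ 2`.
  have h1 : 1 - c ≤ Real.exp (-c) := Real.one_sub_le_exp_neg c
  have h2 : Real.exp (-c) ≤ 1 - c + c ^ 2 := by
    rw [Real.exp_neg]
    have h3 : c + 1 ≤ Real.exp c := Real.add_one_le_exp c
    refine (inv_anti₀ (by linarith) h3).trans ?_
    rw [inv_le_iff_one_le_mul₀ (by linarith)]
    nlinarith [pow_nonneg hc 3]
  rw [abs_le]
  constructor <;> linarith [sq_nonneg c]

/-- One step of Lindeberg's replacement for the cosine. -/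
lemma cos_add_sub_cos_mul_exp_le (x h : ℝ) {c : ℝ} (hc : 0 ≤ c) :
    Real.cos (x + h) - Real.cos x * Real.exp (-c) ≤
      -(Real.sin x) * h + Real.cos x * (c - h ^ 2 / 2) + (5 * |h| ^ 3 + c ^ 2) := by
  have key : Real.cos (x + h) - Real.cos x * Real.exp (-c) -
      (-(Real.sin x) * h + Real.cos x * (c - h ^ 2 / 2)) =
      Real.cos x * (Real.cos h - (1 - h ^ 2 / 2)) - Real.sin x * (Real.sin h - h) -
        Real.cos x * (Real.exp (-c) - (1 - c)) := by
    rw [Real.cos_add]; ring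
  have bound {y z : ℝ} (hy : |y| ≤ 1) : |y * z| ≤ |z| := by
    rw [abs_mul]; exact mul_le_of_le_one_left (abs_nonneg z) hy
  have h1 := (abs_le.1 ((bound (Real.abs_cos_le_one x)).trans (abs_cos_sub_le_cube h))).2
  have h2 := (abs_le.1 ((bound (Real.abs_sin_le_one x)).trans (abs_sin_sub_le_cube h))).1
  have h3 := (abs_le.1 ((bound (Real.abs_cos_le_one x)).trans (abs_exp_neg_sub_le_sq hc))).1
  linarith

end Analysis

/-! ### Conditional expectations tested on events of the sub-σ-field -/

section CondExp

variable {Ω : Type*} {m m0 : MeasurableSpace Ω} {μ : Measure Ω} [IsFiniteMeasure μ]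

lemma integrable_of_forall_abs_le {f : Ω → ℝ} (hf : Measurable f) {C : ℝ}
    (hC : ∀ ω, |f ω| ≤ C) : Integrable f μ :=
  Integrable.of_bound hf.aestronglyMeasurable C (ae_of_all _ hC)

lemma setIntegral_mul_eq_of_condExp_ae_eq (hm : m ≤ m0) {G X Y : Ω → ℝ}
    (hG : StronglyMeasurable[m] G) {C : ℝ} (hGC : ∀ ω, |G ω| ≤ C) (hX : Integrable X μ)
    (hXY : μ[X | m] =ᵐ[μ] Y) {B : Set Ω} (hB : MeasurableSet[m] B) :
    ∫ ω in B, G ω * X ω ∂μ = ∫ ω in B, G ω * Y ω ∂μ := by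
  have hGX : Integrable (G * X) μ :=
    hX.bdd_mul (hG.mono hm).aestronglyMeasurable (ae_of_all _ hGC)
  calc ∫ ω in B, G ω * X ω ∂μ = ∫ ω in B, (μ[G * X | m]) ω ∂μ :=
        (setIntegral_condExp hm hGX hB).symm
    _ = ∫ ω in B, G ω * Y ω ∂μ := by
        refine setIntegral_congr_ae (hm _ hB) ?_
        filter_upwards [condExp_mul_of_stronglyMeasurable_left hG hGX hX, hXY] with ω h1 h2 _
        rw [h1, Pi.mul_apply, h2]

/-- Lets all estimates be proved as inequalities between integrals over `B`. The comparison takes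
place under the trimmed measure, where the events of `m` are all the measurable sets. -/
lemma condExp_ae_le_of_setIntegral_le (hm : m ≤ m0) {f g : Ω → ℝ} (hf : Integrable f μ)
    (hg : Integrable g μ)
    (h : ∀ B, MeasurableSet[m] B → ∫ ω in B, f ω ∂μ ≤ ∫ ω in B, g ω ∂μ) :
    μ[f | m] ≤ᵐ[μ] μ[g | m] := by
  have key : (μ[f | m]) ≤ᵐ[μ.trim hm] (μ[g | m]) := by
    refine ae_le_of_forall_setIntegral_le (integrable_condExp.trim hm stronglyMeasurable_condExp)
      (integrable_condExp.trim hm stronglyMeasurable_condExp) fun B hB _ => ?_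
    rw [← setIntegral_trim hm stronglyMeasurable_condExp hB,
      ← setIntegral_trim hm stronglyMeasurable_condExp hB,
      setIntegral_condExp hm hf hB, setIntegral_condExp hm hg hB]
    exact h B hB
  exact ae_le_of_ae_le_trim key

end CondExp

/-! ### Hunt's lemma for tail oscillations -/

section TailOscillation

variable {Ω : Type*} {m0 : MeasurableSpace Ω}

/-- The oscillation of a sequence after time `n`, relative to its value at time `n`. -/
noncomputable def tailOsc (V : ℕ → Ω → ℝ) (n : ℕ) (ω : Ω) : ℝ :=
  ⨆ k, |V (n + k) ω - V n ω|

variable {V : ℕ → Ω → ℝ} (hV : ∀ k ω, V k ω ∈ Set.Icc (0 : ℝ) 1)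

include hV

lemma abs_sub_le_one_of_mem_Icc (j k : ℕ) (ω : Ω) : |V j ω - V k ω| ≤ 1 := by
  have h1 := hV j ω
  have h2 := hV k ω
  rw [abs_le]
  constructor <;> linarith [h1.1, h1.2, h2.1, h2.2]

lemma abs_sub_le_tailOsc {n k : ℕ} (hnk : n ≤ k) (ω : Ω) : |V k ω - V n ω| ≤ tailOsc V n ω := by
  obtain ⟨j, rfl⟩ := Nat.exists_eq_add_of_le hnk
  refine le_ciSup (f := fun k => |V (n + k) ω - V n ω|) ⟨1, ?_⟩ j
  rintro _ ⟨j, rfl⟩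
  exact abs_sub_le_one_of_mem_Icc hV _ _ ω

lemma tailOsc_mem_Icc (n : ℕ) (ω : Ω) : tailOsc V n ω ∈ Set.Icc (0 : ℝ) 1 :=
  ⟨(abs_nonneg _).trans (abs_sub_le_tailOsc hV le_rfl ω),
    ciSup_le fun _ => abs_sub_le_one_of_mem_Icc hV _ _ ω⟩

omit hV in
lemma measurable_tailOsc (hVm : ∀ k, Measurable (V k)) (n : ℕ) : Measurable (tailOsc V n) :=
  Measurable.iSup fun k => ((hVm (n + k)).sub (hVm n)).abs

omit hV in
lemma measurable_iSup_abs_sub {m' : MeasurableSpace Ω} (hVm : ∀ k, Measurable (V k)) (n : ℕ) :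
    Measurable fun ω => ⨆ p : ℕ × ℕ, |V (n + p.1) ω - V (n + p.2) ω| :=
  Measurable.iSup fun p => ((hVm (n + p.1)).sub (hVm (n + p.2))).abs

/-- Hunt's lemma for the tail oscillation of a bounded almost surely convergent sequence. -/
lemma tendsto_condExp_tailOsc {μ : Measure Ω} [IsFiniteMeasure μ] (ℱ : Filtration ℕ m0)
    (hVm : ∀ k, Measurable[ℱ k] (V k)) {U : Ω → ℝ}
    (hU : ∀ᵐ ω ∂μ, Tendsto (fun k => V k ω) atTop (𝓝 (U ω))) :
    ∀ᵐ ω ∂μ, Tendsto (fun n => (μ[tailOsc V n | ℱ n]) ω) atTop (𝓝 0) := by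
  have hVm0 : ∀ k, Measurable (V k) := fun k => (hVm k).mono (ℱ.le k) le_rfl
  -- `D m` dominates `tailOsc V n` for every `n ≥ m` and is free of `n`, so Lévy's upward theorem
  -- applies to it with `m` fixed; afterwards `D m` is small for large `m` because `V` is Cauchy.
  set D : ℕ → Ω → ℝ := fun m ω => ⨆ p : ℕ × ℕ, |V (m + p.1) ω - V (m + p.2) ω| with hD
  have hbdd : ∀ m ω, BddAbove (Set.range fun p : ℕ × ℕ => |V (m + p.1) ω - V (m + p.2) ω|) := by
    rintro m ω
    refine ⟨1, ?_⟩
    rintro _ ⟨p, rfl⟩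
    exact abs_sub_le_one_of_mem_Icc hV _ _ ω
  have hD0 : ∀ m ω, 0 ≤ D m ω := fun m ω =>
    (abs_nonneg _).trans (le_ciSup (hbdd m ω) (0, 0))
  have hD1 : ∀ m ω, D m ω ≤ 1 := fun m ω =>
    ciSup_le fun _ => abs_sub_le_one_of_mem_Icc hV _ _ ω
  have hDsup : ∀ m, Measurable[⨆ n, ℱ n] (D m) := by
    intro m
    have h : ∀ k, Measurable[⨆ n, ℱ n] (V k) := fun k =>
      (hVm k).mono (le_iSup (fun n => ℱ n) k) le_rfl
    exact measurable_iSup_abs_sub h m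
  have hle : (⨆ n, (ℱ n : MeasurableSpace Ω)) ≤ m0 := iSup_le ℱ.le
  have hDm : ∀ m, Measurable (D m) := fun m => (hDsup m).mono hle le_rfl
  have hDi : ∀ m, Integrable (D m) μ := fun m => integrable_of_forall_abs_le (hDm m) (C := 1)
    fun ω => by rw [abs_of_nonneg (hD0 m ω)]; exact hD1 m ω
  have hosci : ∀ n, Integrable (tailOsc V n) μ := fun n =>
    integrable_of_forall_abs_le (measurable_tailOsc hVm0 n) (C := 1) fun ω => by
      rw [abs_of_nonneg (tailOsc_mem_Icc hV n ω).1]; exact (tailOsc_mem_Icc hV n ω).2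
  have hosc_le : ∀ m n, m ≤ n → ∀ ω, tailOsc V n ω ≤ D m ω := by
    intro m n hmn ω
    obtain ⟨j, rfl⟩ := Nat.exists_eq_add_of_le hmn
    refine ciSup_le fun k => ?_
    have := le_ciSup (hbdd m ω) (j + k, j)
    simpa [add_assoc] using this
  have h1 : ∀ᵐ ω ∂μ, ∀ m n, m ≤ n → (μ[tailOsc V n | ℱ n]) ω ≤ (μ[D m | ℱ n]) ω := by
    refine ae_all_iff.2 fun m => ae_all_iff.2 fun n => ?_
    by_cases hmn : m ≤ n
    · filter_upwards [condExp_mono (m := ℱ n) (hosci n) (hDi m)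
        (ae_of_all _ (hosc_le m n hmn))] with ω h _ using h
    · exact ae_of_all _ fun ω h => absurd h hmn
  have h2 : ∀ᵐ ω ∂μ, ∀ n, 0 ≤ (μ[tailOsc V n | ℱ n]) ω :=
    ae_all_iff.2 fun n => condExp_nonneg (ae_of_all _ fun ω => (tailOsc_mem_Icc hV n ω).1)
  have h3 : ∀ᵐ ω ∂μ, ∀ m, Tendsto (fun n => (μ[D m | ℱ n]) ω) atTop (𝓝 (D m ω)) := by
    refine ae_all_iff.2 fun m => ?_
    have h4 := tendsto_ae_condExp (μ := μ) (ℱ := ℱ) (D m)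
    rwa [condExp_of_stronglyMeasurable hle (hDsup m).stronglyMeasurable (hDi m)] at h4
  filter_upwards [h1, h2, h3, hU] with ω h1 h2 h3 hU
  rw [Metric.tendsto_atTop]
  intro ε hε
  obtain ⟨m, hm⟩ := Metric.cauchySeq_iff.1 hU.cauchySeq (ε / 2) (by positivity)
  have hDε : D m ω ≤ ε / 2 := ciSup_le fun p => by
    have := hm (m + p.1) (by simp) (m + p.2) (by simp)
    rw [Real.dist_eq] at this
    exact this.le
  have h5 : ∀ᶠ n in atTop, (μ[D m | ℱ n]) ω < ε :=
    (h3 m).eventually_lt_const (by linarith)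
  obtain ⟨n0, hn0⟩ := eventually_atTop.1 h5
  refine ⟨max m n0, fun n hn => ?_⟩
  rw [Real.dist_eq, sub_zero, abs_of_nonneg (h2 n)]
  exact (h1 m n (le_of_max_le_left hn)).trans_lt (hn0 n (le_of_max_le_right hn))

end TailOscillation

/-! ### Slow martingales: definition and pointwise replacement error -/

section SlowMartingale

variable {Ω : Type*} {m0 : MeasurableSpace Ω}

/-- A `[0, 1]`-valued martingale `M` whose `k`-th increment is at most `1 / (c + k + 1)` and has
conditional variance `V k / (c + k + 1) ^ 2`. -/
structure IsSlowMartingale (μ : Measure Ω) (ℱ : Filtration ℕ m0) (M V : ℕ → Ω → ℝ) (c : ℝ) :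
    Prop where
  one_le : 1 ≤ c
  measurable_left : ∀ k, Measurable[ℱ k] (M k)
  measurable_right : ∀ k, Measurable[ℱ k] (V k)
  left_mem_Icc : ∀ k ω, M k ω ∈ Set.Icc (0 : ℝ) 1
  right_mem_Icc : ∀ k ω, V k ω ∈ Set.Icc (0 : ℝ) 1
  abs_increment_le : ∀ k ω, |M (k + 1) ω - M k ω| ≤ 1 / (c + k + 1)
  condExp_increment : ∀ k, μ[fun ω => M (k + 1) ω - M k ω | ℱ k] =ᵐ[μ] fun _ => 0
  condExp_increment_sq : ∀ k, μ[fun ω => (M (k + 1) ω - M k ω) ^ 2 | ℱ k] =ᵐ[μ]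
    fun ω => V k ω / (c + k + 1) ^ 2

/-- The pointwise bound of one replacement step, with `s ^ 2` the starting time, `d` the bound of
the increment `δ`, and `q` the telescoping weight. -/
lemma lindeberg_step_le {s d q u δ v v' osc : ℝ} (hs : 1 ≤ s) (hd : 0 ≤ d) (hds : d * s ^ 2 ≤ 1)
    (hq : 0 ≤ q) (hqs : q * s ^ 4 ≤ 1) (hdq : q - d ^ 2 = d * q) (hδ : |δ| ≤ d)
    (hv : v ∈ Set.Icc (0 : ℝ) 1) (hv' : v' ∈ Set.Icc (0 : ℝ) 1) (hosc : |v' - v| ≤ osc) :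
    5 * |-(u * s * δ)| ^ 3 + (u ^ 2 / 2 * v * s ^ 2 * q) ^ 2 +
      |u ^ 2 / 2 * v * s ^ 2 * q - u ^ 2 / 2 * s ^ 2 * (v' * d ^ 2)| ≤
      s ^ 2 * q * ((5 * |u| ^ 3 + u ^ 4 + u ^ 2) / s + u ^ 2 * osc) := by
  have hs0 : 0 < s := by linarith
  have hu4 : 0 ≤ u ^ 4 := by positivity
  have hosc0 : 0 ≤ osc := (abs_nonneg _).trans hosc
  have hdq' : d ^ 2 ≤ q := by nlinarith [mul_nonneg hd hq]
  -- After scaling, a cubic error is `s ^ 3 d ^ 3 ≤ q s`, which is the telescoping weight `s ^ 2 q`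
  -- times `1 / s = n^{-1/2}`.
  have h1 : |-(u * s * δ)| ^ 3 ≤ |u| ^ 3 * (q * s) := by
    rw [abs_neg, abs_mul, abs_mul, abs_of_pos hs0, mul_pow, mul_pow, mul_assoc]
    refine mul_le_mul_of_nonneg_left ?_ (by positivity)
    calc s ^ 3 * |δ| ^ 3 ≤ s ^ 3 * d ^ 3 := by gcongr
      _ = d ^ 2 * s * (d * s ^ 2) := by ring
      _ ≤ q * s * 1 := by gcongr
      _ = q * s := mul_one _
  have h2 : (u ^ 2 / 2 * v * s ^ 2 * q) ^ 2 ≤ u ^ 4 * (q * s) := by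
    have hv2 : v ^ 2 ≤ 1 := pow_le_one₀ hv.1 hv.2
    calc (u ^ 2 / 2 * v * s ^ 2 * q) ^ 2 = (1 / 4) * u ^ 4 * v ^ 2 * (q * (q * s ^ 4)) := by ring
      _ ≤ 1 * u ^ 4 * 1 * (q * s) := by gcongr <;> linarith
      _ = u ^ 4 * (q * s) := by ring
  have h3 : |u ^ 2 / 2 * v * s ^ 2 * q - u ^ 2 / 2 * s ^ 2 * (v' * d ^ 2)| ≤
      u ^ 2 * (q * s) + s ^ 2 * q * (u ^ 2 * osc) := by
    -- The variance mismatch has two sources: `d ^ 2` is traded for `q`, at the cost `d * q`, and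
    -- the current variance `v'` is traded for the frozen one `v`, at the cost `osc`.
    have e : u ^ 2 / 2 * v * s ^ 2 * q - u ^ 2 / 2 * s ^ 2 * (v' * d ^ 2) =
        u ^ 2 / 2 * (v' * (q * (d * s ^ 2)) - (v' - v) * (s ^ 2 * q)) := by
      have : d ^ 2 = q - d * q := by linarith
      rw [this]; ring
    rw [e, abs_mul, abs_of_nonneg (by positivity : 0 ≤ u ^ 2 / 2)]
    have h4 : |v' * (q * (d * s ^ 2)) - (v' - v) * (s ^ 2 * q)| ≤ q * s + osc * (s ^ 2 * q) := by
      refine (norm_sub_le (v' * (q * (d * s ^ 2))) _).trans (add_le_add ?_ ?_)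
      · rw [Real.norm_of_nonneg (mul_nonneg hv'.1 (by positivity))]
        calc v' * (q * (d * s ^ 2)) ≤ 1 * (q * s) := by
              gcongr
              · exact hv'.2
              · linarith
          _ = q * s := one_mul _
      · rw [Real.norm_eq_abs, abs_mul, abs_of_nonneg (by positivity : 0 ≤ s ^ 2 * q)]
        gcongr
    have h5 : 0 ≤ q * s + osc * (s ^ 2 * q) := by positivity
    calc u ^ 2 / 2 * |v' * (q * (d * s ^ 2)) - (v' - v) * (s ^ 2 * q)|
        ≤ u ^ 2 * (q * s + osc * (s ^ 2 * q)) := by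
          gcongr
          linarith [sq_nonneg u]
      _ = _ := by ring
  have e : s ^ 2 * q * ((5 * |u| ^ 3 + u ^ 4 + u ^ 2) / s + u ^ 2 * osc) =
      (5 * |u| ^ 3 + u ^ 4 + u ^ 2) * (q * s) + s ^ 2 * q * (u ^ 2 * osc) := by
    field_simp
  rw [e]
  linarith

end SlowMartingale

/-! ### One replacement step under the integral -/

section SlowMartingale

variable {Ω : Type*} {m0 : MeasurableSpace Ω}

lemma measurable_cos_mul_sub_add {m : MeasurableSpace Ω} {f g : Ω → ℝ} (hf : Measurable f)
    (hg : Measurable g) (u θ : ℝ) : Measurable fun ω => Real.cos (u * (f ω - g ω) + θ) := by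
  fun_prop

lemma measurable_sin_mul_sub_add {m : MeasurableSpace Ω} {f g : Ω → ℝ} (hf : Measurable f)
    (hg : Measurable g) (u θ : ℝ) : Measurable fun ω => Real.sin (u * (f ω - g ω) + θ) := by
  fun_prop

lemma measurable_exp_neg_mul {m : MeasurableSpace Ω} {f : Ω → ℝ} (hf : Measurable f)
    (r : ℝ) : Measurable fun ω => Real.exp (-(r * f ω)) := by
  fun_prop

namespace IsSlowMartingale

variable {μ : Measure Ω} {ℱ : Filtration ℕ m0} {M V : ℕ → Ω → ℝ} {c : ℝ}
  (h : IsSlowMartingale μ ℱ M V c)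

include h

lemma measurable_left' (k : ℕ) : Measurable (M k) := (h.measurable_left k).mono (ℱ.le k) le_rfl

lemma measurable_right' (k : ℕ) : Measurable (V k) := (h.measurable_right k).mono (ℱ.le k) le_rfl

lemma pos (k : ℕ) : 0 < c + k := by
  have := h.one_le
  positivity

lemma increment_bound_nonneg (k : ℕ) : 0 ≤ 1 / (c + k + 1) := by
  have := h.pos k
  positivity

/-- The weight of the step from `k` to `k + 1`, which telescopes. -/
lemma weight_facts {n k : ℕ} (hnk : n ≤ k) :
    (1 / (c + k + 1)) * (n : ℝ) ≤ 1 ∧ 0 ≤ 1 / (c + k) - 1 / (c + k + 1) ∧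
      (1 / (c + k) - 1 / (c + k + 1)) * (n : ℝ) ^ 2 ≤ 1 ∧
      (1 / (c + k) - 1 / (c + k + 1)) - (1 / (c + k + 1)) ^ 2 =
        (1 / (c + k + 1)) * (1 / (c + k) - 1 / (c + k + 1)) := by
  have hk := h.pos k
  have hk1 : 0 < c + k + 1 := by linarith
  have hc := h.one_le
  have hn : (n : ℝ) ≤ k := by exact_mod_cast hnk
  have e : 1 / (c + k) - 1 / (c + k + 1) = 1 / ((c + k) * (c + k + 1)) := by
    field_simp; ring
  have hn0 : (0 : ℝ) ≤ n := n.cast_nonneg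
  refine ⟨?_, ?_, ?_, ?_⟩
  · rw [one_div_mul_eq_div, div_le_one hk1]; linarith
  · rw [e]; positivity
  · rw [e, one_div_mul_eq_div, div_le_one (by positivity), sq]
    gcongr <;> linarith
  · field_simp; ring

variable [IsFiniteMeasure μ]

lemma integrable_increment (k : ℕ) : Integrable (fun ω => M (k + 1) ω - M k ω) μ :=
  integrable_of_forall_abs_le ((h.measurable_left' _).sub (h.measurable_left' _))
    (h.abs_increment_le k)

lemma integrable_increment_sq (k : ℕ) : Integrable (fun ω => (M (k + 1) ω - M k ω) ^ 2) μ :=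
  integrable_of_forall_abs_le (((h.measurable_left' _).sub (h.measurable_left' _)).pow_const 2)
    (C := (1 / (c + k + 1)) ^ 2) fun ω => by
      rw [abs_pow]
      exact pow_le_pow_left₀ (abs_nonneg _) (h.abs_increment_le k ω) 2

/-- One step of the interpolation between the cosine of the rescaled deviation and its Gaussian
value. -/
lemma setIntegral_step_le {n k : ℕ} (hn : 1 ≤ n) (hnk : n ≤ k) (u θ : ℝ) {B : Set Ω}
    (hB : MeasurableSet[ℱ n] B) :
    ∫ ω in B, Real.cos (u * √(n : ℝ) * (M n ω - M (k + 1) ω) + θ) *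
        Real.exp (-(u ^ 2 / 2 * n * (1 / (c + k + 1)) * V n ω)) ∂μ -
      ∫ ω in B, Real.cos (u * √(n : ℝ) * (M n ω - M k ω) + θ) *
        Real.exp (-(u ^ 2 / 2 * n * (1 / (c + k)) * V n ω)) ∂μ ≤
      n * (1 / (c + k) - 1 / (c + k + 1)) *
        ∫ ω in B, ((5 * |u| ^ 3 + u ^ 4 + u ^ 2) / √(n : ℝ) + u ^ 2 * tailOsc V n ω) ∂μ := by
  set s : ℝ := √(n : ℝ) with hs
  have hn1 : (1 : ℝ) ≤ n := by exact_mod_cast hn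
  have hs1 : 1 ≤ s := Real.one_le_sqrt.2 hn1
  have hs2 : s ^ 2 = n := Real.sq_sqrt (by positivity)
  have hs4 : s ^ 4 = (n : ℝ) ^ 2 := by rw [← hs2]; ring
  obtain ⟨w1, w2, w3, w4⟩ := h.weight_facts hnk
  set d : ℝ := 1 / (c + k + 1) with hd
  set q : ℝ := 1 / (c + k) - d with hq
  have hd0 : 0 ≤ d := h.increment_bound_nonneg k
  have hMn : Measurable[ℱ k] (M n) := (h.measurable_left n).mono (ℱ.mono hnk) le_rfl
  have hVn : Measurable[ℱ k] (V n) := (h.measurable_right n).mono (ℱ.mono hnk) le_rfl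
  have hBk : MeasurableSet[ℱ k] B := ℱ.mono hnk _ hB
  set C : Ω → ℝ := fun ω => Real.cos (u * s * (M n ω - M k ω) + θ) with hCdef
  set S : Ω → ℝ := fun ω => Real.sin (u * s * (M n ω - M k ω) + θ) with hSdef
  -- `W` is the Gaussian factor for the increments after `k + 1`, with the variance frozen at its
  -- value at time `n`. It is `ℱ n`-measurable, hence known at time `k`.
  set W : Ω → ℝ := fun ω => Real.exp (-(u ^ 2 / 2 * n * d * V n ω)) with hWdef
  have hCm : Measurable[ℱ k] C := measurable_cos_mul_sub_add hMn (h.measurable_left k) _ _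
  have hSm : Measurable[ℱ k] S := measurable_sin_mul_sub_add hMn (h.measurable_left k) _ _
  have hWm : Measurable[ℱ k] W := measurable_exp_neg_mul hVn _
  have hC1 : ∀ ω, |C ω| ≤ 1 := fun ω => Real.abs_cos_le_one _
  have hS1 : ∀ ω, |S ω| ≤ 1 := fun ω => Real.abs_sin_le_one _
  have hW0 : ∀ ω, 0 ≤ W ω := fun ω => (Real.exp_pos _).le
  have hW1 : ∀ ω, W ω ≤ 1 := fun ω => by
    have := (h.right_mem_Icc n ω).1
    exact Real.exp_le_one_iff.2 (neg_nonpos.2 (by positivity))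
  have hWC : ∀ ω, |W ω * C ω| ≤ 1 := fun ω => by
    rw [abs_mul, abs_of_nonneg (hW0 ω)]
    exact mul_le_one₀ (hW1 ω) (abs_nonneg _) (hC1 ω)
  have hWS : ∀ ω, |W ω * S ω| ≤ 1 := fun ω => by
    rw [abs_mul, abs_of_nonneg (hW0 ω)]
    exact mul_le_one₀ (hW1 ω) (abs_nonneg _) (hS1 ω)
  set Δ : Ω → ℝ := fun ω => M (k + 1) ω - M k ω with hΔdef
  have hΔd : ∀ ω, |Δ ω| ≤ d := h.abs_increment_le k
  have hm0 {f : Ω → ℝ} (hf : Measurable[ℱ k] f) : Measurable f := hf.mono (ℱ.le k) le_rfl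
  set E : Ω → ℝ := fun ω => (5 * |u| ^ 3 + u ^ 4 + u ^ 2) / s + u ^ 2 * tailOsc V n ω with hE
  have hEi : Integrable E μ := by
    refine (integrable_const _).add (Integrable.const_mul ?_ _)
    refine integrable_of_forall_abs_le (measurable_tailOsc h.measurable_right' n) (C := 1) fun ω => ?_
    rw [abs_of_nonneg (tailOsc_mem_Icc h.right_mem_Icc n ω).1]
    exact (tailOsc_mem_Icc h.right_mem_Icc n ω).2
  set a1 : Ω → ℝ := fun ω => (W ω * S ω) * Δ ω with ha1
  set a2 : Ω → ℝ := fun ω => (W ω * C ω) * Δ ω ^ 2 with ha2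
  set a3 : Ω → ℝ := fun ω => (W ω * C ω) * (V k ω / (c + k + 1) ^ 2) with ha3
  have hVk1 : ∀ ω, |V k ω| ≤ 1 := fun ω => by
    rw [abs_of_nonneg (h.right_mem_Icc k ω).1]; exact (h.right_mem_Icc k ω).2
  have ha1i : Integrable a1 μ := (h.integrable_increment k).bdd_mul
    (hm0 (hWm.mul hSm)).aestronglyMeasurable (ae_of_all _ hWS)
  have ha2i : Integrable a2 μ := (h.integrable_increment_sq k).bdd_mul
    (hm0 (hWm.mul hCm)).aestronglyMeasurable (ae_of_all _ hWC)
  have ha3i : Integrable a3 μ :=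
    ((integrable_of_forall_abs_le (h.measurable_right' k) hVk1).div_const _).bdd_mul
      (hm0 (hWm.mul hCm)).aestronglyMeasurable (ae_of_all _ hWC)
  have hi1 : ∫ ω in B, a1 ω ∂μ = 0 := by
    refine (setIntegral_mul_eq_of_condExp_ae_eq (ℱ.le k) (hWm.mul hSm).stronglyMeasurable hWS
      (h.integrable_increment k) (h.condExp_increment k) hBk).trans ?_
    simp
  have hi2 : ∫ ω in B, a2 ω ∂μ = ∫ ω in B, a3 ω ∂μ :=
    setIntegral_mul_eq_of_condExp_ae_eq (ℱ.le k) (hWm.mul hCm).stronglyMeasurable hWC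
      (h.integrable_increment_sq k) (h.condExp_increment_sq k) hBk
  set f : ℕ → Ω → ℝ := fun j ω => Real.cos (u * s * (M n ω - M j ω) + θ) with hf
  have hfi (j : ℕ) (r : ℝ) (hr : 0 ≤ r) :
      Integrable (fun ω => f j ω * Real.exp (-(u ^ 2 / 2 * n * r * V n ω))) μ := by
    refine integrable_of_forall_abs_le (C := 1) ((measurable_cos_mul_sub_add
      (h.measurable_left' n) (h.measurable_left' j) _ _).mul
        (measurable_exp_neg_mul (h.measurable_right' n) _)) fun ω => ?_
    have := (h.right_mem_Icc n ω).1
    rw [abs_mul, abs_of_pos (Real.exp_pos _)]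
    exact mul_le_one₀ (Real.abs_cos_le_one _) (Real.exp_pos _).le
      (Real.exp_le_one_iff.2 (neg_nonpos.2 (by positivity)))
  have hp0 : 0 ≤ 1 / (c + (k : ℝ)) := by have := h.pos k; positivity
  -- The term `a1` is linear in the increment and integrates to `0`; `a2` and `a3` have equal
  -- integrals by the conditional variance formula. Only the error `E` survives integration.
  have hpt : ∀ ω, f (k + 1) ω * Real.exp (-(u ^ 2 / 2 * n * d * V n ω)) -
      f k ω * Real.exp (-(u ^ 2 / 2 * n * (1 / (c + k)) * V n ω)) ≤
      u * s * a1 ω + u ^ 2 / 2 * n * (a3 ω - a2 ω) + n * q * E ω := by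
    intro ω
    have hvn := h.right_mem_Icc n ω
    have hvk := h.right_mem_Icc k ω
    set γ : ℝ := u ^ 2 / 2 * V n ω * s ^ 2 * q with hγ
    have hγ0 : 0 ≤ γ := by have := hvn.1; positivity
    -- `γ` is the part of the Gaussian exponent spent on the step from `k` to `k + 1`; the two
    -- exponents differ by exactly this amount because the weights telescope.
    have hexp : Real.exp (-(u ^ 2 / 2 * n * (1 / (c + k)) * V n ω)) = W ω * Real.exp (-γ) := by
      rw [hWdef, ← Real.exp_add]
      congr 1
      rw [hγ, hq, hs2]; ring
    have harg : f (k + 1) ω =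
        Real.cos ((u * s * (M n ω - M k ω) + θ) + -(u * s * Δ ω)) := by
      simp only [hf, hΔdef]; congr 1; ring
    have hL := cos_add_sub_cos_mul_exp_le (u * s * (M n ω - M k ω) + θ) (-(u * s * Δ ω)) hγ0
    rw [← harg] at hL
    have hR := lindeberg_step_le (u := u) hs1 hd0 (by rw [hs2]; exact w1) w2
      (by rw [hs4]; exact w3) w4 (hΔd ω) hvn hvk (abs_sub_le_tailOsc h.right_mem_Icc hnk ω)
    have hdd : V k ω / (c + k + 1) ^ 2 = V k ω * d ^ 2 := by
      rw [hd, one_div, inv_pow, div_eq_mul_inv]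
    have h1 : W ω * (f (k + 1) ω - C ω * Real.exp (-γ)) ≤
        W ω * (-(S ω) * -(u * s * Δ ω) + C ω * (γ - (-(u * s * Δ ω)) ^ 2 / 2)) +
          (5 * |-(u * s * Δ ω)| ^ 3 + γ ^ 2) := by
      refine (mul_le_mul_of_nonneg_left hL (hW0 ω)).trans ?_
      rw [mul_add]
      refine add_le_add_right (mul_le_of_le_one_left (by positivity) (hW1 ω)) _
    have h2 : W ω * C ω * (γ - u ^ 2 / 2 * s ^ 2 * (V k ω * d ^ 2)) ≤
        |γ - u ^ 2 / 2 * s ^ 2 * (V k ω * d ^ 2)| := by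
      refine (le_abs_self _).trans ?_
      rw [abs_mul]
      exact mul_le_of_le_one_left (abs_nonneg _) (hWC ω)
    rw [hexp]
    change f (k + 1) ω * W ω - C ω * (W ω * Real.exp (-γ)) ≤ _
    simp only [ha1, ha2, ha3, hdd, hE, ← hs2]
    linear_combination h1 + h2 + hR
  rw [← integral_sub (hfi _ _ hd0).integrableOn (hfi _ _ hp0).integrableOn]
  have hi3 : Integrable (fun ω => a3 ω - a2 ω) μ := ha3i.sub ha2i
  have hi4 : Integrable (fun ω => u * s * a1 ω + u ^ 2 / 2 * n * (a3 ω - a2 ω)) μ :=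
    (ha1i.const_mul _).add (hi3.const_mul _)
  have hi5 : Integrable (fun ω => u * s * a1 ω + u ^ 2 / 2 * n * (a3 ω - a2 ω) + n * q * E ω) μ :=
    hi4.add (hEi.const_mul _)
  calc _ ≤ ∫ ω in B, (u * s * a1 ω + u ^ 2 / 2 * n * (a3 ω - a2 ω) + n * q * E ω) ∂μ :=
        integral_mono (((hfi _ _ hd0).sub (hfi _ _ hp0)).integrableOn) hi5.integrableOn hpt
    _ = n * q * ∫ ω in B, E ω ∂μ := by
        rw [integral_add hi4.integrableOn (hEi.const_mul _).integrableOn,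
          integral_add (ha1i.const_mul _).integrableOn (hi3.const_mul _).integrableOn,
          integral_const_mul, integral_const_mul, integral_const_mul,
          integral_sub ha3i.integrableOn ha2i.integrableOn, hi1, hi2]
        ring

end IsSlowMartingale

end SlowMartingale

/-! ### Telescoping, second moments and conditional characteristic functions -/

section SlowMartingale

variable {Ω : Type*} {m0 : MeasurableSpace Ω}

namespace IsSlowMartingale

variable {μ : Measure Ω} [IsFiniteMeasure μ] {ℱ : Filtration ℕ m0} {M V : ℕ → Ω → ℝ} {c : ℝ}
  (h : IsSlowMartingale μ ℱ M V c)

include h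

lemma integrable_tailOsc (n : ℕ) : Integrable (tailOsc V n) μ :=
  integrable_of_forall_abs_le (measurable_tailOsc h.measurable_right' n) (C := 1) fun ω => by
    rw [abs_of_nonneg (tailOsc_mem_Icc h.right_mem_Icc n ω).1]
    exact (tailOsc_mem_Icc h.right_mem_Icc n ω).2

/-- The interpolant keeps the true increments from `n` to `k` and replaces the later ones by a
Gaussian of variance `n V n / (c + k)`. At `k = n` everything is Gaussian, and the errors of the
steps telescope. -/
lemma setIntegral_interpolation_le {n k : ℕ} (hn : 1 ≤ n) (hnk : n ≤ k) (u θ : ℝ) {B : Set Ω}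
    (hB : MeasurableSet[ℱ n] B) :
    ∫ ω in B, Real.cos (u * √(n : ℝ) * (M n ω - M k ω) + θ) *
        Real.exp (-(u ^ 2 / 2 * n * (1 / (c + k)) * V n ω)) ∂μ ≤
      ∫ ω in B, Real.cos θ * Real.exp (-(u ^ 2 / 2 * n * (1 / (c + n)) * V n ω)) ∂μ +
      n * (1 / (c + n) - 1 / (c + k)) *
        ∫ ω in B, ((5 * |u| ^ 3 + u ^ 4 + u ^ 2) / √(n : ℝ) + u ^ 2 * tailOsc V n ω) ∂μ := by
  induction k, hnk using Nat.le_induction with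
  | base => simp
  | succ k hnk ih =>
    have h1 := h.setIntegral_step_le hn hnk u θ hB
    have e : c + ((k + 1 : ℕ) : ℝ) = c + k + 1 := by push_cast; ring
    rw [e]
    linear_combination h1 + ih

/-- The conditional Gaussian estimate for a slow martingale, in integrated form. -/
lemma setIntegral_cos_le {Z : Ω → ℝ}
    (hMZ : ∀ᵐ ω ∂μ, Tendsto (fun k => M k ω) atTop (𝓝 (Z ω))) {n : ℕ} (hn : 1 ≤ n) (u θ : ℝ)
    {B : Set Ω} (hB : MeasurableSet[ℱ n] B) :
    ∫ ω in B, Real.cos (u * √(n : ℝ) * (M n ω - Z ω) + θ) ∂μ ≤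
      ∫ ω in B, (Real.cos θ * Real.exp (-(u ^ 2 / 2 * n * (1 / (c + n)) * V n ω)) +
        ((5 * |u| ^ 3 + u ^ 4 + u ^ 2) / √(n : ℝ) + u ^ 2 * tailOsc V n ω)) ∂μ := by
  have hEi : Integrable (fun ω => (5 * |u| ^ 3 + u ^ 4 + u ^ 2) / √(n : ℝ) +
      u ^ 2 * tailOsc V n ω) μ := (integrable_const _).add ((h.integrable_tailOsc n).const_mul _)
  have hG0 : ∀ (r : ℝ), 0 ≤ r → ∀ ω, Real.exp (-(u ^ 2 / 2 * n * r * V n ω)) ≤ 1 := by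
    intro r hr ω
    have := (h.right_mem_Icc n ω).1
    exact Real.exp_le_one_iff.2 (neg_nonpos.2 (by positivity))
  have hp0 : ∀ k : ℕ, 0 ≤ 1 / (c + (k : ℝ)) := fun k => by have := h.pos k; positivity
  have hGi : Integrable (fun ω => Real.cos θ *
      Real.exp (-(u ^ 2 / 2 * n * (1 / (c + n)) * V n ω))) μ := by
    refine Integrable.const_mul (integrable_of_forall_abs_le (C := 1)
      (measurable_exp_neg_mul (h.measurable_right' n) _) fun ω => ?_) _
    rw [abs_of_pos (Real.exp_pos _)]
    exact hG0 _ (hp0 n) ω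
  have hE0 : 0 ≤ ∫ ω in B, ((5 * |u| ^ 3 + u ^ 4 + u ^ 2) / √(n : ℝ) +
      u ^ 2 * tailOsc V n ω) ∂μ := by
    refine integral_nonneg fun ω => ?_
    have := (tailOsc_mem_Icc h.right_mem_Icc n ω).1
    positivity
  rw [integral_add hGi.integrableOn hEi.integrableOn]
  -- With `n` fixed and `k → ∞` the Gaussian factor tends to `1`, leaving only the true deviation.
  have hlim : Tendsto (fun k => ∫ ω in B, Real.cos (u * √(n : ℝ) * (M n ω - M k ω) + θ) *
      Real.exp (-(u ^ 2 / 2 * n * (1 / (c + k)) * V n ω)) ∂μ) atTop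
      (𝓝 (∫ ω in B, Real.cos (u * √(n : ℝ) * (M n ω - Z ω) + θ) ∂μ)) := by
    refine tendsto_integral_of_dominated_convergence (fun _ => 1) (fun k => ?_)
      (integrable_const _) (fun k => ae_of_all _ fun ω => ?_) ?_
    · exact ((measurable_cos_mul_sub_add (h.measurable_left' n) (h.measurable_left' k) _ _).mul
        (measurable_exp_neg_mul (h.measurable_right' n) _)).aestronglyMeasurable
    · rw [Real.norm_eq_abs, abs_mul, abs_of_pos (Real.exp_pos _)]
      exact mul_le_one₀ (Real.abs_cos_le_one _) (Real.exp_pos _).le (hG0 _ (hp0 k) ω)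
    · refine ae_restrict_of_ae ?_
      filter_upwards [hMZ] with ω hω
      have h1 : Tendsto (fun k : ℕ => 1 / (c + (k : ℝ))) atTop (𝓝 0) := by
        simp_rw [one_div]
        exact tendsto_inv_atTop_zero.comp
          (tendsto_atTop_add_const_left _ _ tendsto_natCast_atTop_atTop)
      have h2 : Tendsto (fun k : ℕ => Real.exp (-(u ^ 2 / 2 * n * (1 / (c + k)) * V n ω))) atTop
          (𝓝 1) := by
        have := (((h1.const_mul (u ^ 2 / 2 * n)).mul_const (V n ω)).neg).rexp
        simpa using this
      have h3 : Tendsto (fun k : ℕ => Real.cos (u * √(n : ℝ) * (M n ω - M k ω) + θ)) atTop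
          (𝓝 (Real.cos (u * √(n : ℝ) * (M n ω - Z ω) + θ))) :=
        (Real.continuous_cos.tendsto _).comp
          (((hω.const_sub _).const_mul _).add_const _)
      simpa using h3.mul h2
  refine le_of_tendsto hlim (eventually_atTop.2 ⟨n, fun k hk => ?_⟩)
  refine (h.setIntegral_interpolation_le hn hk u θ hB).trans (add_le_add_right ?_ _)
  refine mul_le_of_le_one_left hE0 ?_
  have h4 : n * (1 / (c + n)) ≤ 1 := by
    have := h.pos n
    rw [mul_one_div, div_le_one this]
    linarith [h.one_le]
  have h5 : 0 ≤ n * (1 / (c + k)) := mul_nonneg n.cast_nonneg (hp0 k)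
  linarith

/-- Martingale increments are orthogonal on events of `ℱ n`, and each squared increment is at most
the telescoping weight. -/
lemma setIntegral_sq_sub_le {n k : ℕ} (hnk : n ≤ k) {B : Set Ω} (hB : MeasurableSet[ℱ n] B) :
    ∫ ω in B, (M k ω - M n ω) ^ 2 ∂μ ≤ (1 / (c + n) - 1 / (c + k)) * μ.real B := by
  induction k, hnk using Nat.le_induction with
  | base => simp
  | succ k hnk ih =>
    obtain ⟨-, w2, -, w4⟩ := h.weight_facts hnk
    have hd := h.increment_bound_nonneg k
    have e : c + ((k + 1 : ℕ) : ℝ) = c + k + 1 := by push_cast; ring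
    have hMn : Measurable[ℱ k] (M n) := (h.measurable_left n).mono (ℱ.mono hnk) le_rfl
    have hG : Measurable[ℱ k] fun ω => 2 * (M k ω - M n ω) :=
      ((h.measurable_left k).sub hMn).const_mul 2
    have hG2 : ∀ ω, |2 * (M k ω - M n ω)| ≤ 2 := fun ω => by
      rw [abs_mul, abs_two]
      linarith [abs_sub_le_one_of_mem_Icc h.left_mem_Icc k n ω]
    have hi0 := setIntegral_mul_eq_of_condExp_ae_eq (ℱ.le k) hG.stronglyMeasurable hG2
      (h.integrable_increment k) (h.condExp_increment k) (ℱ.mono hnk _ hB)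
    simp only [mul_zero, integral_zero] at hi0
    have hi1 : Integrable (fun ω => (2 * (M k ω - M n ω)) * (M (k + 1) ω - M k ω)) μ :=
      (h.integrable_increment k).bdd_mul (hG.mono (ℱ.le k) le_rfl).aestronglyMeasurable
        (ae_of_all _ hG2)
    have hi2 : Integrable (fun ω => (M k ω - M n ω) ^ 2) μ :=
      integrable_of_forall_abs_le (((h.measurable_left' _).sub (h.measurable_left' _)).pow_const 2)
        (C := 1) fun ω => by
          rw [abs_pow]
          exact pow_le_one₀ (abs_nonneg _) (abs_sub_le_one_of_mem_Icc h.left_mem_Icc k n ω)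
    have hi3 : Integrable (fun ω => (M k ω - M n ω) ^ 2 +
        (2 * (M k ω - M n ω)) * (M (k + 1) ω - M k ω)) μ := hi2.add hi1
    have hi4 := h.integrable_increment_sq k
    have hsplit : ∫ ω in B, (M (k + 1) ω - M n ω) ^ 2 ∂μ = ∫ ω in B, (M k ω - M n ω) ^ 2 ∂μ +
        ∫ ω in B, (M (k + 1) ω - M k ω) ^ 2 ∂μ := by
      calc ∫ ω in B, (M (k + 1) ω - M n ω) ^ 2 ∂μ
          = ∫ ω in B, ((M k ω - M n ω) ^ 2 + (2 * (M k ω - M n ω)) * (M (k + 1) ω - M k ω) +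
            (M (k + 1) ω - M k ω) ^ 2) ∂μ := by
            refine integral_congr_ae (ae_of_all _ fun ω => ?_)
            ring
        _ = _ := by
            rw [integral_add hi3.integrableOn hi4.integrableOn,
              integral_add hi2.integrableOn hi1.integrableOn, hi0, add_zero]
    have hsq : ∫ ω in B, (M (k + 1) ω - M k ω) ^ 2 ∂μ ≤
        (1 / (c + k) - 1 / (c + k + 1)) * μ.real B := by
      calc ∫ ω in B, (M (k + 1) ω - M k ω) ^ 2 ∂μ
          ≤ ∫ ω in B, (1 / (c + k) - 1 / (c + k + 1)) ∂μ := by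
            refine integral_mono hi4.integrableOn (integrable_const _) fun ω => ?_
            have h1 := pow_le_pow_left₀ (abs_nonneg _) (h.abs_increment_le k ω) 2
            rw [sq_abs] at h1
            have := mul_nonneg hd w2
            change _ ≤ 1 / (c + k) - 1 / (c + k + 1)
            linarith
        _ = _ := by simp [mul_comm]
    rw [hsplit, e]
    linarith

/-- The conditional second moment of the rescaled deviation is at most `1`, uniformly in `n`; this
is the source of the equi-Lipschitz bound on characteristic functions. -/
lemma setIntegral_sq_deviation_le {Z : Ω → ℝ}
    (hMZ : ∀ᵐ ω ∂μ, Tendsto (fun k => M k ω) atTop (𝓝 (Z ω))) (n : ℕ)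
    {B : Set Ω} (hB : MeasurableSet[ℱ n] B) :
    ∫ ω in B, (√(n : ℝ) * (M n ω - Z ω)) ^ 2 ∂μ ≤ μ.real B := by
  have hlim : Tendsto (fun k => ∫ ω in B, (M k ω - M n ω) ^ 2 ∂μ) atTop
      (𝓝 (∫ ω in B, (Z ω - M n ω) ^ 2 ∂μ)) := by
    refine tendsto_integral_of_dominated_convergence (fun _ => 1) (fun k => ?_)
      (integrable_const _) (fun k => ae_of_all _ fun ω => ?_) ?_
    · exact (((h.measurable_left' k).sub (h.measurable_left' n)).pow_const 2).aestronglyMeasurable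
    · rw [Real.norm_eq_abs, abs_pow]
      exact pow_le_one₀ (abs_nonneg _) (abs_sub_le_one_of_mem_Icc h.left_mem_Icc k n ω)
    · refine ae_restrict_of_ae ?_
      filter_upwards [hMZ] with ω hω using (hω.sub_const _).pow 2
  have h1 : ∫ ω in B, (Z ω - M n ω) ^ 2 ∂μ ≤ 1 / (c + n) * μ.real B := by
    refine le_of_tendsto hlim (eventually_atTop.2 ⟨n, fun k hk => ?_⟩)
    refine (h.setIntegral_sq_sub_le hk hB).trans ?_
    have := h.pos k
    gcongr
    have : 0 ≤ 1 / (c + (k : ℝ)) := by positivity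
    linarith
  calc ∫ ω in B, (√(n : ℝ) * (M n ω - Z ω)) ^ 2 ∂μ
      = n * ∫ ω in B, (Z ω - M n ω) ^ 2 ∂μ := by
        rw [← integral_const_mul]
        refine integral_congr_ae (ae_of_all _ fun ω => ?_)
        change (√(n : ℝ) * (M n ω - Z ω)) ^ 2 = _
        rw [mul_pow, Real.sq_sqrt n.cast_nonneg]; ring
    _ ≤ n * (1 / (c + n) * μ.real B) := by gcongr
    _ ≤ μ.real B := by
        rw [← mul_assoc]
        refine mul_le_of_le_one_left measureReal_nonneg ?_
        have := h.pos n
        rw [mul_one_div, div_le_one this]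
        linarith [h.one_le]

/-- The conditional characteristic function of the rescaled deviation converges almost surely. -/
lemma tendsto_condExp_cos {U Z : Ω → ℝ} (hZ : Measurable Z)
    (hMZ : ∀ᵐ ω ∂μ, Tendsto (fun k => M k ω) atTop (𝓝 (Z ω)))
    (hVU : ∀ᵐ ω ∂μ, Tendsto (fun k => V k ω) atTop (𝓝 (U ω))) (u θ : ℝ) :
    ∀ᵐ ω ∂μ, Tendsto (fun n : ℕ =>
      (μ[fun ω => Real.cos (u * √(n : ℝ) * (M n ω - Z ω) + θ) | ℱ n]) ω) atTop
      (𝓝 (Real.cos θ * Real.exp (-(u ^ 2 / 2 * U ω)))) := by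
  set G : ℕ → Ω → ℝ := fun n ω => Real.exp (-(u ^ 2 / 2 * n * (1 / (c + n)) * V n ω)) with hG
  set C : ℝ := 5 * |u| ^ 3 + u ^ 4 + u ^ 2 with hC
  have hci : ∀ (n : ℕ) (θ : ℝ), Integrable (fun ω => Real.cos (u * √(n : ℝ) * (M n ω - Z ω) + θ)) μ :=
    fun n θ => integrable_of_forall_abs_le
      (measurable_cos_mul_sub_add (h.measurable_left' n) hZ _ _) fun ω => Real.abs_cos_le_one _
  have hGm : ∀ n, Measurable[ℱ n] (G n) := fun n => measurable_exp_neg_mul (h.measurable_right n) _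
  have hGi : ∀ n, Integrable (G n) μ := fun n => by
    refine integrable_of_forall_abs_le (C := 1) ((hGm n).mono (ℱ.le n) le_rfl) fun ω => ?_
    have h1 := (h.right_mem_Icc n ω).1
    have h2 := h.pos n
    rw [abs_of_pos (Real.exp_pos _)]
    exact Real.exp_le_one_iff.2 (neg_nonpos.2 (by positivity))
  have upper : ∀ n : ℕ, 1 ≤ n → ∀ θ,
      μ[fun ω => Real.cos (u * √(n : ℝ) * (M n ω - Z ω) + θ) | ℱ n] ≤ᵐ[μ]
        fun ω => Real.cos θ * G n ω + (C / √(n : ℝ) + u ^ 2 * (μ[tailOsc V n | ℱ n]) ω) := by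
    intro n hn θ
    have hi1 : Integrable (fun ω => Real.cos θ * G n ω + C / √(n : ℝ)) μ :=
      ((hGi n).const_mul _).add (integrable_const _)
    have hi2 : Integrable (fun ω => u ^ 2 * tailOsc V n ω) μ := (h.integrable_tailOsc n).const_mul _
    have h1 := condExp_ae_le_of_setIntegral_le (ℱ.le n) (hci n θ) (hi1.add hi2) fun B hB => by
      refine (h.setIntegral_cos_le hMZ hn u θ hB).trans_eq ?_
      refine integral_congr_ae (ae_of_all _ fun ω => ?_)
      simp only [Pi.add_apply, hG, hC]; ring
    have h2 : μ[fun ω => Real.cos θ * G n ω + C / √(n : ℝ) | ℱ n] =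
        fun ω => Real.cos θ * G n ω + C / √(n : ℝ) :=
      condExp_of_stronglyMeasurable (ℱ.le n)
        (((hGm n).const_mul _).add_const _).stronglyMeasurable hi1
    have h3 : μ[fun ω => u ^ 2 * tailOsc V n ω | ℱ n] =ᵐ[μ] u ^ 2 • μ[tailOsc V n | ℱ n] :=
      condExp_smul (u ^ 2) (tailOsc V n) (ℱ n)
    filter_upwards [h1, condExp_add hi1 hi2 (ℱ n), h3] with ω h1 h4 h3
    rw [h4, Pi.add_apply, h2, h3, Pi.smul_apply, smul_eq_mul] at h1
    linarith
  have lower : ∀ n : ℕ, 1 ≤ n →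
      (fun ω => Real.cos θ * G n ω - (C / √(n : ℝ) + u ^ 2 * (μ[tailOsc V n | ℱ n]) ω)) ≤ᵐ[μ]
        μ[fun ω => Real.cos (u * √(n : ℝ) * (M n ω - Z ω) + θ) | ℱ n] := by
    intro n hn
    -- Shifting the phase by `π` changes the sign of the cosine, so the upper bound for all phases
    -- contains the lower bound.
    have h1 := upper n hn (θ + Real.pi)
    simp_rw [← add_assoc, Real.cos_add_pi] at h1
    have h2 : μ[fun ω => -Real.cos (u * √(n : ℝ) * (M n ω - Z ω) + θ) | ℱ n] =ᵐ[μ]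
        -μ[fun ω => Real.cos (u * √(n : ℝ) * (M n ω - Z ω) + θ) | ℱ n] := condExp_neg _ _
    filter_upwards [h1, h2] with ω h1 h2
    rw [h2, Pi.neg_apply] at h1
    linarith
  have hall : ∀ᵐ ω ∂μ, ∀ n : ℕ, 1 ≤ n →
      Real.cos θ * G n ω - (C / √(n : ℝ) + u ^ 2 * (μ[tailOsc V n | ℱ n]) ω) ≤
        (μ[fun ω => Real.cos (u * √(n : ℝ) * (M n ω - Z ω) + θ) | ℱ n]) ω ∧
      (μ[fun ω => Real.cos (u * √(n : ℝ) * (M n ω - Z ω) + θ) | ℱ n]) ω ≤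
        Real.cos θ * G n ω + (C / √(n : ℝ) + u ^ 2 * (μ[tailOsc V n | ℱ n]) ω) := by
    refine ae_all_iff.2 fun n => ?_
    by_cases hn : 1 ≤ n
    · filter_upwards [lower n hn, upper n hn θ] with ω h1 h2 _ using ⟨h1, h2⟩
    · exact ae_of_all _ fun ω h => absurd h hn
  filter_upwards [hall, hVU, tendsto_condExp_tailOsc h.right_mem_Icc ℱ h.measurable_right hVU]
    with ω hall hVU hosc
  have hratio : Tendsto (fun n : ℕ => (n : ℝ) * (1 / (c + n))) atTop (𝓝 1) := by
    have h1 : Tendsto (fun n : ℕ => 1 - c * (c + (n : ℝ))⁻¹) atTop (𝓝 (1 - c * 0)) :=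
      ((tendsto_inv_atTop_zero.comp
        (tendsto_atTop_add_const_left _ c tendsto_natCast_atTop_atTop)).const_mul c).const_sub 1
    rw [mul_zero, sub_zero] at h1
    refine h1.congr fun n => ?_
    have := (h.pos n).ne'
    field_simp
    ring
  have hGlim : Tendsto (fun n => Real.cos θ * G n ω) atTop
      (𝓝 (Real.cos θ * Real.exp (-(u ^ 2 / 2 * U ω)))) := by
    have h1 := ((((hratio.const_mul (u ^ 2 / 2)).mul hVU).neg).rexp).const_mul (Real.cos θ)
    rw [mul_one] at h1
    refine h1.congr fun n => ?_
    simp only [hG, mul_assoc]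
  have hEl : Tendsto (fun n : ℕ => C / √(n : ℝ) + u ^ 2 * (μ[tailOsc V n | ℱ n]) ω) atTop
      (𝓝 0) := by
    have h1 : Tendsto (fun n : ℕ => C / √(n : ℝ)) atTop (𝓝 0) :=
      Tendsto.div_atTop tendsto_const_nhds
        (Real.tendsto_sqrt_atTop.comp tendsto_natCast_atTop_atTop)
    simpa using h1.add (hosc.const_mul (u ^ 2))
  have hl := hGlim.sub hEl
  have hu := hGlim.add hEl
  rw [sub_zero] at hl
  rw [add_zero] at hu
  exact tendsto_of_tendsto_of_tendsto_of_le_of_le' hl hu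
    (eventually_atTop.2 ⟨1, fun n hn => (hall n hn).1⟩)
    (eventually_atTop.2 ⟨1, fun n hn => (hall n hn).2⟩)

end IsSlowMartingale

end SlowMartingale

/-! ### Integrals against versions of conditional distributions -/

section Versions

variable {Ω S : Type*} {m m0 : MeasurableSpace Ω} [mS : MeasurableSpace S]

lemma integral_bind_kernel {μ : Measure Ω} [IsFiniteMeasure μ] {K : Kernel Ω S} [IsMarkovKernel K]
    {f : S → ℝ} (hf : Measurable f) {C : ℝ} (hC : ∀ x, |f x| ≤ C) :
    ∫ x, f x ∂(μ.bind K) = ∫ ω, ∫ x, f x ∂(K ω) ∂μ := by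
  have e : (K ∘ₖ Kernel.const Unit μ) () = μ.bind K := by
    rw [Kernel.comp_apply, Kernel.const_apply]
  have hfi : Integrable f ((K ∘ₖ Kernel.const Unit μ) ()) := integrable_of_forall_abs_le hf hC
  rw [← e, Kernel.integral_comp hfi, Kernel.const_apply]

lemma IsCondDistribVersion.integral_ae_eq_condExp {μ : Measure Ω} [IsFiniteMeasure μ]
    (hm : m ≤ m0) {X : Ω → S} (hX : Measurable X) {κ : @Kernel Ω S m mS}
    (hκ : IsCondDistribVersion μ m X κ) {f : S → ℝ} (hf : Measurable f) {C : ℝ}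
    (hC : ∀ x, |f x| ≤ C) :
    (fun ω => ∫ x, f x ∂(κ ω)) =ᵐ[μ] μ[fun ω => f (X ω) | m] := by
  have hκp := hκ.isProbabilityMeasure
  have : @IsMarkovKernel Ω S m mS κ := @IsMarkovKernel.mk Ω S m mS κ hκp
  -- The same kernel regarded as measurable for `m0`, so that it can be mixed under restrictions of
  -- `μ`.
  set κ' : Kernel Ω S := @Kernel.comap Ω S m mS Ω m0 κ id (measurable_id'' hm) with hκ'
  have hκκ' : ∀ ω, κ' ω = κ ω := fun ω => by rw [hκ', Kernel.comap_apply]; rfl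
  have : IsMarkovKernel κ' := ⟨fun ω => by rw [hκκ']; exact hκp ω⟩
  have hsm : StronglyMeasurable[m] fun ω => ∫ x, f x ∂(κ ω) :=
    StronglyMeasurable.integral_kernel hf.stronglyMeasurable
  have hb : ∀ ω, |∫ x, f x ∂(κ ω)| ≤ C := fun ω => by
    have := hκp ω
    refine (norm_integral_le_of_norm_le_const
      (ae_of_all _ fun x => (Real.norm_eq_abs (f x)).trans_le (hC x))).trans_eq ?_
    simp
  refine ae_eq_condExp_of_forall_setIntegral_eq hm
    (integrable_of_forall_abs_le (hf.comp hX) fun ω => hC _)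
    (fun B _ _ => (integrable_of_forall_abs_le (hsm.mono hm).measurable hb).integrableOn)
    (fun B hB _ => ?_) hsm.aestronglyMeasurable
  -- The defining property of a version identifies these two measures on sets; integrating `f`
  -- against both then replaces any approximation of `f` by simple functions.
  have hmeas : (μ.restrict B).bind κ' = (μ.restrict B).map X := by
    ext A hA
    rw [Measure.bind_apply hA κ'.aemeasurable, Measure.map_apply hX hA]
    have h1 : ∀ ω, κ' ω A = ENNReal.ofReal ((κ ω).real A) := fun ω => by
      have := hκp ω
      rw [hκκ', ofReal_measureReal]
    have h2 : Measurable fun ω => (κ' ω).real A := (κ'.measurable_coe hA).ennreal_toReal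
    have h3 : Integrable (fun ω => (κ ω).real A) μ := by
      simp_rw [← hκκ']
      exact integrable_of_forall_abs_le h2 (C := 1) fun ω => by
        rw [abs_of_nonneg measureReal_nonneg]; exact measureReal_le_one
    simp_rw [h1]
    rw [← ofReal_integral_eq_lintegral_ofReal h3.integrableOn
      (ae_of_all _ fun ω => measureReal_nonneg)]
    have h4 : ∫ ω in B, (κ ω).real A ∂μ = (μ.restrict B).real (X ⁻¹' A) := by
      have hind : Integrable ((X ⁻¹' A).indicator fun _ => (1 : ℝ)) μ :=
        (integrable_const _).indicator (hX hA)
      calc ∫ ω in B, (κ ω).real A ∂μ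
          = ∫ ω in B, (μ[(X ⁻¹' A).indicator (fun _ => (1 : ℝ)) | m]) ω ∂μ :=
            integral_congr_ae (ae_restrict_of_ae (hκ.ae_eq A hA))
        _ = ∫ ω in B, (X ⁻¹' A).indicator (fun _ => (1 : ℝ)) ω ∂μ :=
            setIntegral_condExp hm hind hB
        _ = _ := integral_indicator_one (hX hA)
    rw [h4, ofReal_measureReal]
  calc ∫ ω in B, ∫ x, f x ∂(κ ω) ∂μ = ∫ ω in B, ∫ x, f x ∂(κ' ω) ∂μ := by simp_rw [hκκ']
    _ = ∫ x, f x ∂((μ.restrict B).bind κ') := (integral_bind_kernel hf hC).symm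
    _ = ∫ ω in B, f (X ω) ∂μ := by
        rw [hmeas, integral_map hX.aemeasurable hf.aestronglyMeasurable]

lemma exists_isCondDistribVersion [StandardBorelSpace S] [TopologicalSpace S] [PolishSpace S]
    [BorelSpace S] [Nonempty S] {μ : Measure Ω} [IsFiniteMeasure μ] (hm : m ≤ m0) {X : Ω → S}
    (hX : Measurable X) : ∃ κ : @Kernel Ω S m mS, IsCondDistribVersion μ m X κ := by
  have hid : @Measurable Ω Ω m0 m id := measurable_id'' hm
  refine ⟨@condDistrib Ω Ω S _ _ _ m0 m X id μ _, ⟨fun ω => ?_, fun B hB => ?_⟩⟩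
  · exact inferInstance
  · have := condDistrib_ae_eq_condExp (μ := μ) (mβ := m) hid hX hB
    rwa [MeasurableSpace.comap_id] at this

end Versions

/-! ### Weak convergence from rational frequencies -/

section RationalFrequencies

lemma norm_cexp_sub_cexp_le (u v x : ℝ) {R : ℝ} (hR : 2 ≤ |u - v| * R) :
    ‖Complex.exp (u * x * Complex.I) - Complex.exp (v * x * Complex.I)‖ ≤
      |u - v| * min |x| R := by
  have e : Complex.exp (u * x * Complex.I) - Complex.exp (v * x * Complex.I) =
      Complex.exp ((v * x : ℝ) * Complex.I) *
        (Complex.exp (Complex.I * ((u - v) * x : ℝ)) - 1) := by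
    rw [mul_sub, ← Complex.exp_add, mul_one]
    congr 2 <;> push_cast <;> ring
  rw [e, norm_mul, Complex.norm_exp_ofReal_mul_I, one_mul, mul_min_of_nonneg _ _ (abs_nonneg _)]
  refine le_min ?_ ?_
  · refine Real.norm_exp_I_mul_ofReal_sub_one_le.trans_eq ?_
    rw [Real.norm_eq_abs, abs_mul]
  · refine le_trans ?_ hR
    refine (norm_sub_le _ _).trans ?_
    rw [mul_comm Complex.I, Complex.norm_exp_ofReal_mul_I, norm_one]
    norm_num

lemma integrable_cexp_mul_I (ν : Measure ℝ) [IsFiniteMeasure ν] (u : ℝ) :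
    Integrable (fun x : ℝ => Complex.exp (u * x * Complex.I)) ν := by
  refine Integrable.of_bound (by fun_prop) 1 (ae_of_all _ fun x => ?_)
  rw [← Complex.ofReal_mul, Complex.norm_exp_ofReal_mul_I]

/-- The truncation keeps the test function bounded. It costs nothing: two points of the unit circle
are at distance at most `2`, so any `R ≥ 2 / |u - v|` gives the Lipschitz bound. -/
lemma norm_charFun_sub_le {ν : Measure ℝ} [IsProbabilityMeasure ν] {C : ℝ}
    (hν : ∀ R : ℕ, ∫ x, min |x| (R : ℝ) ∂ν ≤ C) (u v : ℝ) :
    ‖charFun ν u - charFun ν v‖ ≤ |u - v| * C := by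
  rcases eq_or_ne u v with rfl | huv
  · simp
  have h0 : 0 < |u - v| := abs_pos.2 (sub_ne_zero.2 huv)
  obtain ⟨R, hR⟩ := exists_nat_ge (2 / |u - v|)
  have hR' : 2 ≤ |u - v| * R := by rwa [div_le_iff₀' h0] at hR
  have hi : Integrable (fun x : ℝ => min |x| (R : ℝ)) ν :=
    integrable_of_forall_abs_le (by fun_prop) (C := R) fun x => by
      rw [abs_of_nonneg (le_min (abs_nonneg x) R.cast_nonneg)]
      exact min_le_right _ _
  rw [charFun_apply_real, charFun_apply_real,
    ← integral_sub (integrable_cexp_mul_I ν u) (integrable_cexp_mul_I ν v)]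
  calc _ ≤ ∫ x, |u - v| * min |x| (R : ℝ) ∂ν :=
        norm_integral_le_of_norm_le (hi.const_mul _)
          (ae_of_all _ fun x => norm_cexp_sub_cexp_le u v x hR')
    _ ≤ |u - v| * C := by
        rw [integral_const_mul]
        exact mul_le_mul_of_nonneg_left (hν R) h0.le

/-- If truncated first absolute moments are uniformly bounded, convergence of the characteristic
functions at the rational frequencies implies weak convergence. -/
lemma weaklyConverges_of_tendsto_charFun_rat {ν : ℕ → Measure ℝ} {ν' : Measure ℝ}
    (hν : ∀ n, IsProbabilityMeasure (ν n)) (hν' : IsProbabilityMeasure ν') {C : ℝ}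
    (hC : ∀ n, ∀ R : ℕ, ∫ x, min |x| (R : ℝ) ∂(ν n) ≤ C)
    (h : ∀ q : ℚ, Tendsto (fun n => charFun (ν n) (q : ℝ)) atTop (𝓝 (charFun ν' (q : ℝ)))) :
    WeaklyConverges ν ν' := by
  have hC0 : 0 ≤ C := by simpa using hC 0 0
  refine ⟨hν, hν', ?_⟩
  have key : Tendsto (β := ProbabilityMeasure ℝ) (fun n => ⟨ν n, hν n⟩) atTop (𝓝 ⟨ν', hν'⟩) := by
    refine ProbabilityMeasure.tendsto_of_tendsto_charFun fun u => ?_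
    change Tendsto (fun n => charFun (ν n) u) atTop (𝓝 (charFun ν' u))
    rw [Metric.tendsto_atTop]
    intro ε hε
    have hcont : ∀ᶠ v in 𝓝 u, dist (charFun ν' v) (charFun ν' u) < ε / 3 :=
      Metric.tendsto_nhds.1 (continuous_charFun.tendsto u) (ε / 3) (by positivity)
    have hnear : ∀ᶠ v in 𝓝 u, dist v u < ε / (3 * (C + 1)) :=
      Metric.ball_mem_nhds u (by positivity)
    obtain ⟨δ, hδ, hball⟩ := Metric.eventually_nhds_iff.1 (hcont.and hnear)
    -- A rational `q` near `u` serves all `n` at once, since the Lipschitz constant `C` does not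
    -- depend on `n`.
    obtain ⟨q, hq⟩ := Rat.denseRange_cast.exists_dist_lt u hδ
    obtain ⟨h1, h2⟩ := hball (by rwa [dist_comm] at hq)
    obtain ⟨n0, hn0⟩ := Metric.tendsto_atTop.1 (h q) (ε / 3) (by positivity)
    refine ⟨n0, fun n hn => ?_⟩
    have h3 : dist (charFun (ν n) u) (charFun (ν n) q) ≤ ε / 3 := by
      have := hν n
      rw [dist_eq_norm]
      refine (norm_charFun_sub_le (hC n) u q).trans ?_
      rw [← Real.dist_eq, dist_comm]
      calc dist (q : ℝ) u * C ≤ ε / (3 * (C + 1)) * (C + 1) := by gcongr; linarith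
        _ = ε / 3 := by field_simp
    have h4 := hn0 n hn
    have h5 := dist_triangle4 (charFun (ν n) u) (charFun (ν n) q) (charFun ν' q) (charFun ν' u)
    linarith
  exact ProbabilityMeasure.tendsto_iff_forall_integral_tendsto.1 key

/-- The phases `0` and `-π/2` give the real and imaginary parts, so estimates for a cosine with
arbitrary phase suffice. -/
lemma charFun_eq_integral_cos (ν : Measure ℝ) [IsFiniteMeasure ν] (u : ℝ) :
    charFun ν u = (∫ x, Real.cos (u * x + 0) ∂ν : ℝ) +
      (∫ x, Real.cos (u * x + -(Real.pi / 2)) ∂ν : ℝ) * Complex.I := by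
  have hi : ∀ θ : ℝ, Integrable (fun x => Real.cos (u * x + θ)) ν := fun θ =>
    integrable_of_forall_abs_le (by fun_prop) (C := 1) fun x => Real.abs_cos_le_one _
  rw [charFun_apply_real, ← integral_complex_ofReal, ← integral_complex_ofReal,
    ← integral_mul_const, ← integral_add (hi 0).ofReal ((hi _).ofReal.mul_const _)]
  refine integral_congr_ae (ae_of_all _ fun x => ?_)
  simp only [add_zero, ← sub_eq_add_neg, Real.cos_sub_pi_div_two]
  rw [Complex.exp_mul_I]
  push_cast
  rfl

end RationalFrequencies

/-! ### From almost sure conditional convergence to stable convergence -/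

section Stable

variable {Ω : Type*} {m m0 : MeasurableSpace Ω}

/-- The limsup is `m`-measurable everywhere, so the exceptional null set need not belong to `m`. -/
lemma aestronglyMeasurable_of_tendsto_ae_of_measurable {μ : Measure Ω}
    {g : ℕ → Ω → ℝ} (hg : ∀ n, Measurable[m] (g n)) {f : Ω → ℝ}
    (hf : ∀ᵐ ω ∂μ, Tendsto (fun n => g n ω) atTop (𝓝 (f ω))) : AEStronglyMeasurable[m] f μ := by
  refine ⟨fun ω => limsup (fun n => g n ω) atTop, (Measurable.limsup hg).stronglyMeasurable, ?_⟩
  filter_upwards [hf] with ω hω using hω.limsup_eq.symm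

lemma integral_mul_condExp_eq (hm : m ≤ m0) {μ : Measure Ω}
    [IsFiniteMeasure μ] {f g : Ω → ℝ} (hf : AEStronglyMeasurable[m] f μ) {C : ℝ}
    (hC : ∀ᵐ ω ∂μ, |f ω| ≤ C) (hg : Integrable g μ) :
    ∫ ω, f ω * (μ[g | m]) ω ∂μ = ∫ ω, f ω * g ω ∂μ := by
  have hfg : Integrable (f * g) μ := hg.bdd_mul (hf.mono hm) hC
  rw [← integral_condExp hm (f := fun ω => f ω * g ω)]
  exact integral_congr_ae (condExp_mul_of_aestronglyMeasurable_left hf hfg hg).symm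

/-- Almost sure convergence of the conditional expectations given the filtration implies
convergence of the integrals over every event, for bounded variables in the limit σ-field. -/
lemma tendsto_setIntegral_of_tendsto_condExp {μ : Measure Ω} [IsFiniteMeasure μ]
    (ℱ : Filtration ℕ m0) {F : ℕ → Ω → ℝ} {G : Ω → ℝ} {C : ℝ} (hFC : ∀ n ω, |F n ω| ≤ C)
    (hF : ∀ n, AEStronglyMeasurable[⨆ n, ℱ n] (F n) μ) (hGC : ∀ ω, |G ω| ≤ C)
    (hFG : ∀ᵐ ω ∂μ, Tendsto (fun n => (μ[F n | ℱ n]) ω) atTop (𝓝 (G ω)))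
    {H : Set Ω} (hH : MeasurableSet H) :
    Tendsto (fun n => ∫ ω in H, F n ω ∂μ) atTop (𝓝 (∫ ω in H, G ω ∂μ)) := by
  have hle : (⨆ n, (ℱ n : MeasurableSpace Ω)) ≤ m0 := iSup_le ℱ.le
  set I : Ω → ℝ := H.indicator fun _ => 1 with hI
  have hIi : Integrable I μ := (integrable_const _).indicator hH
  have hFi : ∀ n, Integrable (F n) μ := fun n =>
    Integrable.of_bound ((hF n).mono hle) C (ae_of_all _ (hFC n))
  have hset : ∀ f : Ω → ℝ, ∫ ω in H, f ω ∂μ = ∫ ω, f ω * I ω ∂μ := fun f => by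
    rw [← integral_indicator hH]
    refine integral_congr_ae (ae_of_all _ fun ω => ?_)
    by_cases hω : ω ∈ H <;> simp [hI, hω]
  have hI01 : ∀ ω, 0 ≤ I ω ∧ I ω ≤ 1 := fun ω => by
    by_cases hω : ω ∈ H <;> simp [hI, hω]
  have hcond : ∀ m : MeasurableSpace Ω, m ≤ m0 → ∀ᵐ ω ∂μ, |(μ[I | m]) ω| ≤ 1 := fun m hm => by
    have h1 : 0 ≤ᵐ[μ] μ[I | m] := condExp_nonneg (ae_of_all _ fun ω => (hI01 ω).1)
    have h2 : μ[I | m] ≤ᵐ[μ] μ[fun _ => (1 : ℝ) | m] :=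
      condExp_mono hIi (integrable_const _) (ae_of_all _ fun ω => (hI01 ω).2)
    rw [condExp_const hm] at h2
    filter_upwards [h1, h2] with ω h1 h2
    rw [abs_of_nonneg h1]
    exact h2
  have hGs : AEStronglyMeasurable[⨆ n, ℱ n] G μ := by
    refine aestronglyMeasurable_of_tendsto_ae_of_measurable (fun n => ?_) hFG
    exact (stronglyMeasurable_condExp.mono (le_iSup (fun n => (ℱ n : MeasurableSpace Ω)) n)).measurable
  have hlevy := tendsto_ae_condExp (μ := μ) (ℱ := ℱ) I
  set J : Ω → ℝ := μ[I | ⨆ n, ℱ n] with hJ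
  have hJ1 : ∀ᵐ ω ∂μ, |J ω| ≤ 1 := hcond _ hle
  have hn1 : ∀ᵐ ω ∂μ, ∀ n, |(μ[I | ℱ n]) ω| ≤ 1 := ae_all_iff.2 fun n => hcond _ (ℱ.le n)
  -- `F n` is measurable for the limit σ-field up to a null set, so the indicator of `H` may be
  -- replaced by its projection `J`. By Lévy's theorem `J` is close to its conditional expectation
  -- given `ℱ n`, and against the latter `F n` may be projected on `ℱ n`.
  have e1 : ∀ n, ∫ ω in H, F n ω ∂μ = ∫ ω, F n ω * (J ω - (μ[I | ℱ n]) ω) ∂μ +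
      ∫ ω, (μ[I | ℱ n]) ω * (μ[F n | ℱ n]) ω ∂μ := by
    intro n
    have hFJ : Integrable (fun ω => F n ω * J ω) μ :=
      integrable_condExp.bdd_mul ((hF n).mono hle) (ae_of_all _ (hFC n))
    have hFJn : Integrable (fun ω => F n ω * (μ[I | ℱ n]) ω) μ :=
      integrable_condExp.bdd_mul ((hF n).mono hle) (ae_of_all _ (hFC n))
    rw [hset, ← integral_mul_condExp_eq hle (hF n) (ae_of_all _ (hFC n)) hIi,
      integral_mul_condExp_eq (ℱ.le n) stronglyMeasurable_condExp.aestronglyMeasurable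
        (hcond _ (ℱ.le n)) (hFi n)]
    simp_rw [mul_sub]
    rw [integral_sub hFJ hFJn]
    simp_rw [mul_comm ((μ[I | ℱ n]) _) (F n _)]
    ring
  have hcF : ∀ n, ∀ᵐ ω ∂μ, |(μ[F n | ℱ n]) ω| ≤ C := fun n => by
    have h1 : μ[F n | ℱ n] ≤ᵐ[μ] μ[fun _ => C | ℱ n] :=
      condExp_mono (hFi n) (integrable_const _) (ae_of_all _ fun ω => (abs_le.1 (hFC n ω)).2)
    have h2 : μ[fun _ => -C | ℱ n] ≤ᵐ[μ] μ[F n | ℱ n] :=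
      condExp_mono (integrable_const _) (hFi n) (ae_of_all _ fun ω => (abs_le.1 (hFC n ω)).1)
    rw [condExp_const (ℱ.le n)] at h1 h2
    filter_upwards [h1, h2] with ω h1 h2 using abs_le.2 ⟨h2, h1⟩
  have hm0 : ∀ (f : Ω → ℝ) n, AEStronglyMeasurable (μ[f | ℱ n]) μ := fun f n =>
    integrable_condExp.aestronglyMeasurable
  have l1 : Tendsto (fun n => ∫ ω, F n ω * (J ω - (μ[I | ℱ n]) ω) ∂μ) atTop (𝓝 0) := by
    rw [← integral_zero Ω ℝ (μ := μ)]
    refine tendsto_integral_of_dominated_convergence (fun _ => C * 2) (fun n => ?_)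
      (integrable_const _) (fun n => ?_) ?_
    · exact ((hF n).mono hle).mul (integrable_condExp.aestronglyMeasurable.sub (hm0 _ n))
    · filter_upwards [hJ1, hn1] with ω h1 h2
      rw [Real.norm_eq_abs, abs_mul]
      have h3 : |J ω - (μ[I | ℱ n]) ω| ≤ 2 := by
        have h4 := abs_le.1 h1
        have h5 := abs_le.1 (h2 n)
        rw [abs_le]
        constructor <;> linarith [h4.1, h4.2, h5.1, h5.2]
      exact mul_le_mul (hFC n ω) h3 (abs_nonneg _) ((abs_nonneg _).trans (hFC n ω))
    · filter_upwards [hlevy] with ω hω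
      have h1 : Tendsto (fun n => J ω - (μ[I | ℱ n]) ω) atTop (𝓝 0) := by
        simpa using hω.const_sub (J ω)
      refine squeeze_zero_norm (a := fun n => C * |J ω - (μ[I | ℱ n]) ω|) (fun n => ?_) ?_
      · rw [norm_mul]
        exact mul_le_mul_of_nonneg_right (hFC n ω) (norm_nonneg _)
      · simpa using (h1.abs).const_mul C
  have l2 : Tendsto (fun n => ∫ ω, (μ[I | ℱ n]) ω * (μ[F n | ℱ n]) ω ∂μ) atTop
      (𝓝 (∫ ω, J ω * G ω ∂μ)) := by
    refine tendsto_integral_of_dominated_convergence (fun _ => 1 * C) (fun n => ?_)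
      (integrable_const _) (fun n => ?_) ?_
    · exact (hm0 _ n).mul (hm0 _ n)
    · filter_upwards [hn1, hcF n] with ω h1 h2
      rw [Real.norm_eq_abs, abs_mul]
      exact mul_le_mul (h1 n) h2 (abs_nonneg _) zero_le_one
    · filter_upwards [hlevy, hFG] with ω h1 h2 using h1.mul h2
  have e2 : ∫ ω, J ω * G ω ∂μ = ∫ ω in H, G ω ∂μ := by
    rw [hset, ← integral_mul_condExp_eq hle hGs (ae_of_all _ hGC) hIi]
    simp_rw [mul_comm (J _)]
    rfl
  simp_rw [e1, ← e2]
  simpa using l1.add l2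

/-- Almost sure convergence of the conditional expectations of bounded continuous functions
implies stable convergence, for variables in the limit σ-field. -/
lemma stablyConverges_of_tendsto_condExp {S : Type*} [TopologicalSpace S] [PolishSpace S]
    [mS : MeasurableSpace S] [BorelSpace S] {μ : Measure Ω} [IsProbabilityMeasure μ]
    (ℱ : Filtration ℕ m0) {Y : ℕ → Ω → S} {K : Kernel Ω S} [IsMarkovKernel K]
    (hY : ∀ n, Measurable (Y n))
    (hYs : ∀ n, ∀ f : S →ᵇ ℝ, AEStronglyMeasurable[⨆ n, ℱ n] (fun ω => f (Y n ω)) μ)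
    (hYK : ∀ f : S →ᵇ ℝ, ∀ᵐ ω ∂μ,
      Tendsto (fun n => (μ[fun ω => f (Y n ω) | ℱ n]) ω) atTop (𝓝 (∫ x, f x ∂(K ω)))) :
    StablyConverges μ Y K := by
  refine ⟨hY, fun H hH hH0 => ?_⟩
  have hcond : IsProbabilityMeasure (cond μ H) := cond_isProbabilityMeasure hH0
  refine ⟨fun n => Measure.isProbabilityMeasure_map (hY n).aemeasurable, ?_, fun f => ?_⟩
  · refine ⟨?_⟩
    rw [Measure.bind_apply MeasurableSet.univ K.aemeasurable]
    simp
  have hfC : ∀ x, |f x| ≤ ‖f‖ := fun x => f.norm_coe_le_norm x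
  have hfm : Measurable f := f.continuous.measurable
  have hGC : ∀ ω, |∫ x, f x ∂(K ω)| ≤ ‖f‖ := fun ω => by
    refine (norm_integral_le_of_norm_le_const (ae_of_all _ f.norm_coe_le_norm)).trans_eq ?_
    simp
  have hlim := tendsto_setIntegral_of_tendsto_condExp ℱ (F := fun n ω => f (Y n ω))
    (G := fun ω => ∫ x, f x ∂(K ω)) (fun n ω => hfC _) (fun n => hYs n f) hGC (hYK f) hH
  have e : ∀ g : Ω → ℝ, ∫ ω, g ω ∂(cond μ H) = (μ H)⁻¹.toReal * ∫ ω in H, g ω ∂μ := fun g => by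
    rw [ProbabilityTheory.cond, integral_smul_measure, smul_eq_mul]
  simp_rw [integral_map (hY _).aemeasurable hfm.aestronglyMeasurable]
  rw [integral_bind_kernel hfm hfC]
  simp_rw [e]
  exact hlim.const_mul _

end Stable

/-! ### The two limit theorems for slow martingales -/

section SlowMartingale

variable {Ω : Type*} {m0 : MeasurableSpace Ω}

instance isMarkovKernel_gaussianKernel (w : Ω → ℝ) (hw : Measurable w) :
    IsMarkovKernel (gaussianKernel w hw) :=
  ⟨fun ω => inferInstanceAs (IsProbabilityMeasure (gaussianReal 0 (Real.toNNReal (w ω))))⟩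

lemma gaussianKernel_apply (w : Ω → ℝ) (hw : Measurable w) (ω : Ω) :
    gaussianKernel w hw ω = gaussianReal 0 (Real.toNNReal (w ω)) := rfl

namespace IsSlowMartingale

variable {μ : Measure Ω} [IsProbabilityMeasure μ] {ℱ : Filtration ℕ m0} {M V : ℕ → Ω → ℝ} {c : ℝ}
  (h : IsSlowMartingale μ ℱ M V c)

include h

omit [IsProbabilityMeasure μ] in
lemma measurable_deviation {Z : Ω → ℝ} (hZ : Measurable Z) (n : ℕ) :
    Measurable fun ω => √(n : ℝ) * (M n ω - Z ω) :=
  ((h.measurable_left' n).sub hZ).const_mul _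

/-- Follows from `|y| ≤ (1 + y ^ 2) / 2` and the bound on the second moment. -/
lemma condExp_min_abs_deviation_le {Z : Ω → ℝ} (hZ : Measurable Z)
    (hMZ : ∀ᵐ ω ∂μ, Tendsto (fun k => M k ω) atTop (𝓝 (Z ω))) (n R : ℕ) :
    ∀ᵐ ω ∂μ, (μ[fun ω => min |√(n : ℝ) * (M n ω - Z ω)| (R : ℝ) | ℱ n]) ω ≤ 1 := by
  have hYm := h.measurable_deviation hZ n
  have hmi : Integrable (fun ω => min |√(n : ℝ) * (M n ω - Z ω)| (R : ℝ)) μ :=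
    integrable_of_forall_abs_le (hYm.abs.min measurable_const) (C := R) fun ω => by
      rw [abs_of_nonneg (le_min (abs_nonneg _) R.cast_nonneg)]
      exact min_le_right _ _
  have hZ01 : ∀ᵐ ω ∂μ, |M n ω - Z ω| ≤ 1 := by
    filter_upwards [hMZ] with ω hω
    have h1 : Tendsto (fun k => |M n ω - M k ω|) atTop (𝓝 |M n ω - Z ω|) := (hω.const_sub _).abs
    exact le_of_tendsto' h1 fun k => abs_sub_le_one_of_mem_Icc h.left_mem_Icc n k ω
  have hsq : Integrable (fun ω => (√(n : ℝ) * (M n ω - Z ω)) ^ 2) μ := by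
    refine Integrable.of_bound (hYm.pow_const 2).aestronglyMeasurable n ?_
    filter_upwards [hZ01] with ω hω
    rw [Real.norm_eq_abs, abs_pow, abs_mul, mul_pow, abs_of_nonneg (Real.sqrt_nonneg _),
      Real.sq_sqrt n.cast_nonneg]
    exact mul_le_of_le_one_right n.cast_nonneg (pow_le_one₀ (abs_nonneg _) hω)
  have key := condExp_ae_le_of_setIntegral_le (ℱ.le n) hmi (integrable_const (1 : ℝ))
    fun B hB => by
      have hB2 := h.setIntegral_sq_deviation_le hMZ n hB
      calc ∫ ω in B, min |√(n : ℝ) * (M n ω - Z ω)| (R : ℝ) ∂μ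
          ≤ ∫ ω in B, (1 / 2 + 1 / 2 * (√(n : ℝ) * (M n ω - Z ω)) ^ 2) ∂μ := by
            refine integral_mono hmi.integrableOn
              ((integrable_const _).add (hsq.const_mul _)).integrableOn fun ω => ?_
            refine (min_le_left _ _).trans ?_
            rw [← sq_abs]
            nlinarith [sq_nonneg (|√(n : ℝ) * (M n ω - Z ω)| - 1)]
        _ = 1 / 2 * μ.real B + 1 / 2 * ∫ ω in B, (√(n : ℝ) * (M n ω - Z ω)) ^ 2 ∂μ := by
            rw [integral_add (integrable_const _) (hsq.const_mul _).integrableOn,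
              integral_const_mul]
            simp [mul_comm]
        _ ≤ μ.real B := by linarith
        _ = ∫ ω in B, (1 : ℝ) ∂μ := by simp
  rwa [condExp_const (ℱ.le n)] at key

/-- A slow martingale satisfies a central limit theorem in the sense of almost sure conditional
convergence. -/
theorem asConditionallyConverges {w Z : Ω → ℝ} (hw : Measurable w) (hZ : Measurable Z)
    (hMZ : ∀ᵐ ω ∂μ, Tendsto (fun k => M k ω) atTop (𝓝 (Z ω)))
    (hVw : ∀ᵐ ω ∂μ, Tendsto (fun k => V k ω) atTop (𝓝 (w ω))) :
    ASConditionallyConverges μ (fun n => ℱ n) (fun (n : ℕ) ω => √(n : ℝ) * (M n ω - Z ω))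
      (gaussianKernel w hw) := by
  refine ⟨ℱ.le, h.measurable_deviation hZ,
    fun n => exists_isCondDistribVersion (ℱ.le n) (h.measurable_deviation hZ n), fun κ hκ => ?_⟩
  -- The truncation levels are natural numbers and the frequencies below are rational, so one null
  -- set covers them all.
  have hR : ∀ᵐ ω ∂μ, ∀ n R : ℕ, ∫ x, min |x| (R : ℝ) ∂(κ n ω) ≤ 1 := by
    refine ae_all_iff.2 fun n => ae_all_iff.2 fun R => ?_
    have h1 := (hκ n).integral_ae_eq_condExp (ℱ.le n) (h.measurable_deviation hZ n)
      (f := fun x => min |x| (R : ℝ)) (by fun_prop) (C := R) fun x => by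
        rw [abs_of_nonneg (le_min (abs_nonneg x) R.cast_nonneg)]
        exact min_le_right _ _
    filter_upwards [h1, h.condExp_min_abs_deviation_le hZ hMZ n R] with ω h1 h2
    rw [h1]
    exact h2
  have hcos : ∀ θ : ℝ, ∀ᵐ ω ∂μ, ∀ q : ℚ,
      Tendsto (fun n => ∫ x, Real.cos (q * x + θ) ∂(κ n ω)) atTop
        (𝓝 (Real.cos θ * Real.exp (-((q : ℝ) ^ 2 / 2 * w ω)))) := by
    refine fun θ => ae_all_iff.2 fun q => ?_
    have h1 : ∀ᵐ ω ∂μ, ∀ n : ℕ, ∫ x, Real.cos (q * x + θ) ∂(κ n ω) =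
        (μ[fun ω => Real.cos (q * √(n : ℝ) * (M n ω - Z ω) + θ) | ℱ n]) ω := by
      refine ae_all_iff.2 fun n => ?_
      have h2 := (hκ n).integral_ae_eq_condExp (ℱ.le n) (h.measurable_deviation hZ n)
        (f := fun x => Real.cos (q * x + θ)) (by fun_prop) (C := 1) fun x => Real.abs_cos_le_one _
      simp_rw [← mul_assoc] at h2
      exact h2
    filter_upwards [h1, h.tendsto_condExp_cos hZ hMZ hVw q θ] with ω h1 h2
    simp_rw [h1]
    exact h2
  have hw0 : ∀ᵐ ω ∂μ, 0 ≤ w ω := by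
    filter_upwards [hVw] with ω hω
    exact ge_of_tendsto' hω fun k => (h.right_mem_Icc k ω).1
  filter_upwards [hR, hcos 0, hcos (-(Real.pi / 2)), hw0] with ω hR h1 h2 hw0
  refine weaklyConverges_of_tendsto_charFun_rat (fun n => (hκ n).isProbabilityMeasure ω)
    inferInstance hR fun q => ?_
  have hp : ∀ n, IsProbabilityMeasure (κ n ω) := fun n => (hκ n).isProbabilityMeasure ω
  simp_rw [charFun_eq_integral_cos]
  -- Only the limit is folded back, to use the closed form of the Gaussian characteristic function;
  -- the sequence stays split into cosines.
  rw [← charFun_eq_integral_cos, gaussianKernel_apply, charFun_gaussianReal,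
    Real.coe_toNNReal _ hw0]
  have h3 := ((Complex.continuous_ofReal.tendsto _).comp (h1 q)).add
    (((Complex.continuous_ofReal.tendsto _).comp (h2 q)).mul_const Complex.I)
  simp only [Real.cos_neg, Real.cos_pi_div_two, Real.cos_zero, zero_mul, one_mul,
    Complex.ofReal_zero, add_zero] at h3
  convert h3 using 2
  · simp
  · push_cast
    congr 1
    ring

/-- A slow martingale satisfies a stable central limit theorem. -/
theorem stablyConverges {w Z : Ω → ℝ} (hw : Measurable w) (hZ : Measurable Z)
    (hMZ : ∀ᵐ ω ∂μ, Tendsto (fun k => M k ω) atTop (𝓝 (Z ω)))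
    (hVw : ∀ᵐ ω ∂μ, Tendsto (fun k => V k ω) atTop (𝓝 (w ω))) :
    StablyConverges μ (fun (n : ℕ) ω => √(n : ℝ) * (M n ω - Z ω)) (gaussianKernel w hw) := by
  obtain ⟨-, -, hex, hall⟩ := h.asConditionallyConverges hw hZ hMZ hVw
  choose κ hκ using hex
  have hconv := hall κ hκ
  have hsup : ∀ n, Measurable[⨆ n, ℱ n] (M n) := fun n =>
    (h.measurable_left n).mono (le_iSup (fun n => (ℱ n : MeasurableSpace Ω)) n) le_rfl
  have hZs := aestronglyMeasurable_of_tendsto_ae_of_measurable hsup hMZ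
  refine stablyConverges_of_tendsto_condExp ℱ (h.measurable_deviation hZ) (fun n f => ?_)
    fun f => ?_
  · exact f.continuous.comp_aestronglyMeasurable
      (((hsup n).stronglyMeasurable.aestronglyMeasurable.sub hZs).const_mul _)
  · have h1 : ∀ᵐ ω ∂μ, ∀ n : ℕ, ∫ x, f x ∂(κ n ω) =
        (μ[fun ω => f (√(n : ℝ) * (M n ω - Z ω)) | ℱ n]) ω :=
      ae_all_iff.2 fun n => (hκ n).integral_ae_eq_condExp (ℱ.le n)
        (h.measurable_deviation hZ n) f.continuous.measurable f.norm_coe_le_norm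
    filter_upwards [hconv, h1] with ω hω h1
    simp_rw [← h1]
    exact hω.2.2 f

end IsSlowMartingale

end SlowMartingale

/-! ### Almost sure convergence: supermartingales and a Robbins-Monro argument -/

section ProbabilisticConvergence

variable {Ω : Type*} {m0 : MeasurableSpace Ω} {μ : Measure Ω} [IsProbabilityMeasure μ]

/-- A positive limit would make the series dominate a multiple of a tail of the harmonic series. -/
lemma eq_zero_of_summable_div {e : ℕ → ℝ} {c : ℕ} {l : ℝ}
    (hs : Summable fun t => e t / ((c : ℝ) + t + 1)) (he : Tendsto e atTop (𝓝 l)) (hl : 0 ≤ l) :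
    l = 0 := by
  by_contra hne
  have hpos : 0 < l := lt_of_le_of_ne hl (Ne.symm hne)
  obtain ⟨n0, hn0⟩ := eventually_atTop.1 (he.eventually_const_lt (half_lt_self hpos))
  have h1 : Summable fun t : ℕ => l / 2 * (1 / ((t + n0 + (c + 1) : ℕ) : ℝ)) := by
    refine Summable.of_nonneg_of_le (fun t => by positivity) (fun t => ?_)
      ((summable_nat_add_iff n0).2 hs)
    rw [mul_one_div]
    push_cast
    have h2 : (c : ℝ) + (t + n0) + 1 = t + n0 + (c + 1) := by ring
    rw [h2]
    gcongr
    exact (hn0 (t + n0) (by simp)).le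
  rw [summable_mul_left_iff (by positivity)] at h1
  have h2 : Summable fun t : ℕ => 1 / ((t + (n0 + (c + 1)) : ℕ) : ℝ) := by
    simpa only [add_assoc] using h1
  exact Real.not_summable_one_div_natCast
    ((summable_nat_add_iff (f := fun n : ℕ => 1 / (n : ℝ)) (n0 + (c + 1))).1 h2)

lemma exists_ae_tendsto_of_submartingale_of_abs_le {ℱ : Filtration ℕ m0} {X : ℕ → Ω → ℝ} {C : ℝ}
    (hX : Submartingale X ℱ μ) (hC : ∀ t ω, |X t ω| ≤ C) :
    ∃ L : Ω → ℝ, Measurable L ∧ ∀ᵐ ω ∂μ, Tendsto (fun t => X t ω) atTop (𝓝 (L ω)) := by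
  refine ⟨fun ω => limsup (fun t => X t ω) atTop,
    Measurable.limsup fun t => ((hX.stronglyMeasurable t).mono (ℱ.le t)).measurable, ?_⟩
  have hbdd : ∀ t, eLpNorm (X t) 1 μ ≤ C.toNNReal := fun t => by
    refine (eLpNorm_le_of_ae_bound (C := C) (ae_of_all _ (hC t))).trans_eq ?_
    simp
    rfl
  filter_upwards [hX.exists_ae_tendsto_of_bdd hbdd] with ω ⟨l, hl⟩
  rwa [hl.limsup_eq]

/-- A Robbins-Monro type lemma: an adapted `[0, 1]`-valued process contracted on average at rate
`β / t`, up to errors of order `1 / t ^ 2`, tends to zero almost surely. -/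
lemma tendsto_zero_of_condExp_succ_le (ℱ : Filtration ℕ m0) {Q : ℕ → Ω → ℝ}
    (hQm : ∀ t, Measurable[ℱ t] (Q t)) (hQ : ∀ t ω, Q t ω ∈ Set.Icc (0 : ℝ) 1) {c : ℕ}
    (hc : 1 ≤ c) {β C : ℝ} (hβ : 0 < β) (hC : 0 ≤ C)
    (hstep : ∀ t : ℕ, μ[Q (t + 1) | ℱ t] ≤ᵐ[μ]
      fun ω => Q t ω - β * (Q t ω / ((c : ℝ) + t + 1)) + C / ((c : ℝ) + t + 1) ^ 2) :
    ∀ᵐ ω ∂μ, Tendsto (fun t => Q t ω) atTop (𝓝 0) := by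
  have hc' : (1 : ℝ) ≤ c := by exact_mod_cast hc
  have hQm0 : ∀ t, Measurable (Q t) := fun t => (hQm t).mono (ℱ.le t) le_rfl
  have hQi : ∀ t, Integrable (Q t) μ := fun t => integrable_of_forall_abs_le (hQm0 t) (C := 1)
    fun ω => by rw [abs_of_nonneg (hQ t ω).1]; exact (hQ t ω).2
  -- Since `C / (c + t + 1) ^ 2 + r (t + 1) ≤ r t`, adding `r` absorbs the errors and turns `Q` into
  -- a supermartingale.
  set r : ℕ → ℝ := fun t => C / ((c : ℝ) + t) with hr
  have hr0 : ∀ t, 0 ≤ r t := fun t => by positivity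
  have hrC : ∀ t, r t ≤ C := fun t => by
    have : (1 : ℝ) ≤ c + t := by have := t.cast_nonneg (α := ℝ); linarith
    exact div_le_self hC this
  have hrstep : ∀ t : ℕ, C / ((c : ℝ) + t + 1) ^ 2 + r (t + 1) ≤ r t := fun t => by
    have h0 : 0 < (c : ℝ) + t := by positivity
    simp only [hr]
    push_cast
    rw [← add_assoc, div_add_div _ _ (by positivity) (by positivity),
      div_le_div_iff₀ (by positivity) h0]
    have : 0 ≤ C * ((c : ℝ) + t + 1) := by positivity
    nlinarith
  have hrlim : Tendsto r atTop (𝓝 0) :=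
    Tendsto.div_atTop tendsto_const_nhds
      (tendsto_atTop_add_const_left _ _ tendsto_natCast_atTop_atTop)
  set X : ℕ → Ω → ℝ := fun t ω => Q t ω + r t with hX
  have hXi : ∀ t, Integrable (X t) μ := fun t => (hQi t).add (integrable_const _)
  have hXb : ∀ t ω, |X t ω| ≤ 1 + C := fun t ω => by
    rw [abs_of_nonneg (add_nonneg (hQ t ω).1 (hr0 t))]
    exact add_le_add (hQ t ω).2 (hrC t)
  have hXstep : ∀ t, μ[X (t + 1) | ℱ t] ≤ᵐ[μ]
      fun ω => X t ω - β * (Q t ω / ((c : ℝ) + t + 1)) := by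
    intro t
    have h1 := condExp_add (hQi (t + 1)) (integrable_const (r (t + 1))) (ℱ t) (μ := μ)
    rw [condExp_const (ℱ.le t)] at h1
    filter_upwards [h1, hstep t] with ω h1 h2
    change (μ[(Q (t + 1) + fun _ => r (t + 1)) | ℱ t]) ω ≤ _
    rw [h1, Pi.add_apply]
    simp only [hX]
    linarith [hrstep t]
  have hsuper : Supermartingale X ℱ μ := by
    refine supermartingale_nat (fun t => ((hQm t).add_const _).stronglyMeasurable) hXi fun t => ?_
    filter_upwards [hXstep t] with ω h1
    refine h1.trans (sub_le_self _ ?_)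
    have := (hQ t ω).1
    positivity
  obtain ⟨L', -, hL'⟩ := exists_ae_tendsto_of_submartingale_of_abs_le hsuper.neg fun t ω => by
    rw [Pi.neg_apply, Pi.neg_apply, abs_neg]; exact hXb t ω
  set L : Ω → ℝ := fun ω => -L' ω with hL
  have hXL : ∀ᵐ ω ∂μ, Tendsto (fun t => X t ω) atTop (𝓝 (L ω)) := by
    filter_upwards [hL'] with ω hω
    simpa using hω.neg
  have hL0 : 0 ≤ᵐ[μ] L := by
    filter_upwards [hXL] with ω hω
    exact ge_of_tendsto' hω fun t => add_nonneg (hQ t ω).1 (hr0 t)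
  have hLi : Integrable L μ := by
    refine Integrable.of_bound
      (aestronglyMeasurable_of_tendsto_ae atTop (fun t => (hXi t).aestronglyMeasurable) hXL)
      (1 + C) ?_
    filter_upwards [hXL] with ω hω
    exact le_of_tendsto' hω.norm fun t => hXb t ω
  have hEX : Tendsto (fun t => ∫ ω, X t ω ∂μ) atTop (𝓝 (∫ ω, L ω ∂μ)) :=
    tendsto_integral_of_dominated_convergence (fun _ => 1 + C)
      (fun t => (hXi t).aestronglyMeasurable) (integrable_const _)
      (fun t => ae_of_all _ (hXb t)) hXL
  have hXQ : ∀ t, ∫ ω, X t ω ∂μ = ∫ ω, Q t ω ∂μ + r t := fun t => by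
    rw [integral_add (hQi t) (integrable_const _)]; simp
  have hEQ : Tendsto (fun t => ∫ ω, Q t ω ∂μ) atTop (𝓝 (∫ ω, L ω ∂μ)) := by
    have := hEX.sub hrlim
    simpa [hXQ] using this
  -- Telescoping the expectations makes `∑ E[Q t] / (c + t + 1)` finite, while `E[Q t]` tends to
  -- `E[L]`; hence `E[L] = 0`.
  have hdecr : ∀ t : ℕ, β * ((∫ ω, Q t ω ∂μ) / ((c : ℝ) + t + 1)) ≤
      ∫ ω, X t ω ∂μ - ∫ ω, X (t + 1) ω ∂μ := by
    intro t
    have hi : Integrable (fun ω => β * (Q t ω / ((c : ℝ) + t + 1))) μ :=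
      ((hQi t).div_const _).const_mul _
    have h1 : ∫ ω, X (t + 1) ω ∂μ ≤
        ∫ ω, (X t ω - β * (Q t ω / ((c : ℝ) + t + 1))) ∂μ := by
      rw [← integral_condExp (ℱ.le t)]
      exact integral_mono_ae integrable_condExp ((hXi t).sub hi) (hXstep t)
    rw [integral_sub (hXi t) hi, integral_const_mul, integral_div] at h1
    linarith
  have hsum : Summable fun t : ℕ => β * ((∫ ω, Q t ω ∂μ) / ((c : ℝ) + t + 1)) := by
    refine summable_of_sum_range_le (c := ∫ ω, X 0 ω ∂μ) (fun t => ?_) fun n => ?_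
    · have : 0 ≤ ∫ ω, Q t ω ∂μ := integral_nonneg fun ω => (hQ t ω).1
      positivity
    · refine (Finset.sum_le_sum fun t _ => hdecr t).trans ?_
      rw [Finset.sum_range_sub']
      have : 0 ≤ ∫ ω, X n ω ∂μ := integral_nonneg fun ω => add_nonneg (hQ n ω).1 (hr0 n)
      linarith
  rw [summable_mul_left_iff hβ.ne'] at hsum
  have hL1 := eq_zero_of_summable_div hsum hEQ (integral_nonneg_of_ae hL0)
  rw [integral_eq_zero_iff_of_nonneg_ae hL0 hLi] at hL1
  filter_upwards [hXL, hL1] with ω h1 h2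
  rw [h2, Pi.zero_apply] at h1
  have := h1.sub hrlim
  simpa [hX] using this

namespace IsSlowMartingale

variable {ℱ : Filtration ℕ m0} {M V : ℕ → Ω → ℝ} {c : ℝ}

/-- A slow martingale converges almost surely. -/
lemma exists_ae_tendsto (h : IsSlowMartingale μ ℱ M V c) :
    ∃ Z : Ω → ℝ, Measurable Z ∧ ∀ᵐ ω ∂μ, Tendsto (fun k => M k ω) atTop (𝓝 (Z ω)) := by
  have hMb : ∀ k ω, |M k ω| ≤ 1 := fun k ω => by
    rw [abs_of_nonneg (h.left_mem_Icc k ω).1]; exact (h.left_mem_Icc k ω).2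
  have hsub : Submartingale M ℱ μ := by
    refine submartingale_of_condExp_sub_nonneg_nat
      (fun k => (h.measurable_left k).stronglyMeasurable)
      (fun k => integrable_of_forall_abs_le (h.measurable_left' k) (hMb k)) fun k => ?_
    exact (h.condExp_increment k).symm.le
  exact exists_ae_tendsto_of_submartingale_of_abs_le hsub hMb

end IsSlowMartingale

end ProbabilisticConvergence

/-! ### Conditional covariances and the variance of a sum -/

section ConditionalVariance

variable {Ω : Type*} {m m0 : MeasurableSpace Ω} {μ : Measure Ω} [IsFiniteMeasure μ]

lemma condExp_mul_sub_sub_ae_eq (hm : m ≤ m0) {A B p q r : Ω → ℝ} {C : ℝ} (hA : Integrable A μ)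
    (hB : Integrable B μ) (hAB : Integrable (fun ω => A ω * B ω) μ)
    (hp : Measurable[m] p) (hq : Measurable[m] q) (hpC : ∀ ω, |p ω| ≤ C) (hqC : ∀ ω, |q ω| ≤ C)
    (hAp : μ[A | m] =ᵐ[μ] p) (hBq : μ[B | m] =ᵐ[μ] q)
    (hr : μ[fun ω => A ω * B ω | m] =ᵐ[μ] r) :
    μ[fun ω => (A ω - p ω) * (B ω - q ω) | m] =ᵐ[μ] fun ω => r ω - p ω * q ω := by
  have hpm := (hp.mono hm le_rfl).aestronglyMeasurable (μ := μ)
  have hqm := (hq.mono hm le_rfl).aestronglyMeasurable (μ := μ)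
  have hpi : Integrable p μ := Integrable.of_bound hpm C (ae_of_all _ hpC)
  have hpB : Integrable (p * B) μ := hB.bdd_mul hpm (ae_of_all _ hpC)
  have hqA : Integrable (q * A) μ := hA.bdd_mul hqm (ae_of_all _ hqC)
  have hqp : Integrable (q * p) μ := hpi.bdd_mul hqm (ae_of_all _ hqC)
  have e : (fun ω => (A ω - p ω) * (B ω - q ω)) =
      ((fun ω => A ω * B ω) - p * B) - (q * A - q * p) := by
    funext ω; simp only [Pi.sub_apply, Pi.mul_apply]; ring
  rw [e]
  have h4 : μ[q * p | m] = q * p :=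
    condExp_of_stronglyMeasurable hm (hq.mul hp).stronglyMeasurable hqp
  filter_upwards [condExp_sub (hAB.sub hpB) (hqA.sub hqp) m, condExp_sub hAB hpB m,
    condExp_sub hqA hqp m, hAp, hBq, hr,
    condExp_mul_of_stronglyMeasurable_left hp.stronglyMeasurable hpB hB,
    condExp_mul_of_stronglyMeasurable_left hq.stronglyMeasurable hqA hA]
    with ω h1 h2 h3 h5 h6 h7 h8 h9
  rw [h1, Pi.sub_apply, h2, h3, Pi.sub_apply, Pi.sub_apply, h4, h7, h8, h9]
  simp only [Pi.mul_apply]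
  rw [h5, h6]
  ring

omit [IsFiniteMeasure μ] in
lemma condExp_sum_sq_ae_eq {ι : Type*} [Fintype ι] [DecidableEq ι] {X : ι → Ω → ℝ} {v : ι → Ω → ℝ}
    (hX : ∀ i j, Integrable (fun ω => X i ω * X j ω) μ)
    (hdiag : ∀ i, μ[fun ω => X i ω * X i ω | m] =ᵐ[μ] v i)
    (hoff : ∀ i j, i ≠ j → μ[fun ω => X i ω * X j ω | m] =ᵐ[μ] fun _ => 0) :
    μ[fun ω => (∑ i, X i ω) ^ 2 | m] =ᵐ[μ] fun ω => ∑ i, v i ω := by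
  have e : (fun ω => (∑ i, X i ω) ^ 2) = ∑ p : ι × ι, fun ω => X p.1 ω * X p.2 ω := by
    funext ω
    rw [sq, Finset.sum_mul_sum, Finset.sum_apply, Fintype.sum_prod_type]
  rw [e]
  have h1 : ∀ᵐ ω ∂μ, ∀ p : ι × ι, (μ[fun ω => X p.1 ω * X p.2 ω | m]) ω =
      if p.1 = p.2 then v p.1 ω else 0 := by
    refine ae_all_iff.2 fun ⟨i, j⟩ => ?_
    by_cases hij : i = j
    · subst hij
      filter_upwards [hdiag i] with ω hω
      simpa using hω
    · filter_upwards [hoff i j hij] with ω hω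
      simpa [hij] using hω
  filter_upwards [condExp_finsetSum (s := Finset.univ)
    (f := fun p : ι × ι => fun ω => X p.1 ω * X p.2 ω) (fun p _ => hX p.1 p.2) m, h1] with ω h2 h1
  rw [h2, Finset.sum_apply]
  simp_rw [h1]
  rw [Fintype.sum_prod_type]
  simp

end ConditionalVariance

/-! ### The urn model as a slow martingale, and synchronization -/

namespace PolyaUrns

variable {Ω : Type*} {N : ℕ}

/-- The conditional probability, given the past, that the next ball added in urn `j` is red. -/
noncomputable def redProb (a b : ℕ) (α : ℝ) (red : ℕ → Fin N → Set Ω) (t : ℕ) (j : Fin N)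
    (ω : Ω) : ℝ :=
  α * total a b red t ω + (1 - α) * frac a b red t j ω

section Pointwise

variable {a b : ℕ} {α : ℝ} (red : ℕ → Fin N → Set Ω)

lemma indicator_one_mem_Icc (s : Set Ω) (ω : Ω) :
    s.indicator (fun _ => (1 : ℝ)) ω ∈ Set.Icc (0 : ℝ) 1 := by
  by_cases h : ω ∈ s <;> simp [h]

lemma frac_mem_Icc (ha : 1 ≤ a) (t : ℕ) (j : Fin N) (ω : Ω) :
    frac a b red t j ω ∈ Set.Icc (0 : ℝ) 1 := by
  have ha' : (1 : ℝ) ≤ a := by exact_mod_cast ha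
  have h0 : 0 ≤ ∑ k ∈ Finset.range t, (red k j).indicator (fun _ => (1 : ℝ)) ω :=
    Finset.sum_nonneg fun k _ => (indicator_one_mem_Icc _ ω).1
  have h1 : ∑ k ∈ Finset.range t, (red k j).indicator (fun _ => (1 : ℝ)) ω ≤ t := by
    refine (Finset.sum_le_sum fun k _ => (indicator_one_mem_Icc (red k j) ω).2).trans_eq ?_
    simp
  have hb : (0 : ℝ) ≤ b := b.cast_nonneg
  refine ⟨div_nonneg (by linarith) (by positivity), ?_⟩
  exact (div_le_one (by positivity)).2 (by linarith)

lemma frac_succ (ha : 1 ≤ a) (t : ℕ) (j : Fin N) (ω : Ω) :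
    frac a b red (t + 1) j ω = frac a b red t j ω +
      ((red t j).indicator (fun _ => (1 : ℝ)) ω - frac a b red t j ω) / ((a : ℝ) + b + t + 1) := by
  have ha' : (1 : ℝ) ≤ a := by exact_mod_cast ha
  have h1 : (a : ℝ) + b + t ≠ 0 := by positivity
  have h2 : (a : ℝ) + b + t + 1 ≠ 0 := by positivity
  simp only [frac, Finset.sum_range_succ]
  push_cast
  rw [← add_assoc ((a : ℝ) + b)]
  field_simp
  ring

lemma average_mem_Icc (hN : 1 < N) {x : Fin N → ℝ} (hx : ∀ i, x i ∈ Set.Icc (0 : ℝ) 1) :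
    (1 / (N : ℝ)) * ∑ i, x i ∈ Set.Icc (0 : ℝ) 1 := by
  have hN0 : (0 : ℝ) < N := by exact_mod_cast (by omega : 0 < N)
  refine ⟨mul_nonneg (by positivity) (Finset.sum_nonneg fun i _ => (hx i).1), ?_⟩
  rw [one_div_mul_eq_div, div_le_one hN0]
  refine (Finset.sum_le_sum fun i _ => (hx i).2).trans_eq ?_
  simp

lemma total_mem_Icc (hN : 1 < N) (ha : 1 ≤ a) (t : ℕ) (ω : Ω) :
    total a b red t ω ∈ Set.Icc (0 : ℝ) 1 :=
  average_mem_Icc hN fun i => frac_mem_Icc red ha t i ω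

lemma total_succ (ha : 1 ≤ a) (t : ℕ) (ω : Ω) :
    total a b red (t + 1) ω = total a b red t ω +
      ((1 / (N : ℝ)) * ∑ i, (red t i).indicator (fun _ => (1 : ℝ)) ω - total a b red t ω) /
        ((a : ℝ) + b + t + 1) := by
  simp only [total, frac_succ red ha, Finset.sum_add_distrib, ← Finset.sum_div,
    Finset.sum_sub_distrib]
  ring

lemma redProb_mem_Icc (hN : 1 < N) (ha : 1 ≤ a) (hα0 : 0 < α) (hα1 : α ≤ 1) (t : ℕ) (j : Fin N)
    (ω : Ω) : redProb a b α red t j ω ∈ Set.Icc (0 : ℝ) 1 := by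
  have h1 := total_mem_Icc (b := b) red hN ha t ω
  have h2 := frac_mem_Icc (b := b) red ha t j ω
  have h3 : 0 ≤ 1 - α := by linarith
  refine ⟨add_nonneg (mul_nonneg hα0.le h1.1) (mul_nonneg h3 h2.1), ?_⟩
  unfold redProb
  linarith [mul_le_mul_of_nonneg_left h1.2 hα0.le, mul_le_mul_of_nonneg_left h2.2 h3]

/-- The interaction cancels on average; this is what makes the total proportion a martingale for
every `α`. -/
lemma sum_redProb (hN : 1 < N) (t : ℕ) (ω : Ω) :
    (1 / (N : ℝ)) * ∑ i, redProb a b α red t i ω = total a b red t ω := by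
  have hN0 : (N : ℝ) ≠ 0 := by exact_mod_cast (by omega : N ≠ 0)
  simp only [redProb, Finset.sum_add_distrib, Finset.sum_const, Finset.card_univ, Fintype.card_fin,
    nsmul_eq_mul, ← Finset.mul_sum]
  have h1 : ∑ i, frac a b red t i ω = N * total a b red t ω := by
    unfold total; field_simp
  rw [h1]
  field_simp
  ring

end Pointwise

/-- The rescaled conditional variance of the increments of the total proportion. -/
noncomputable def condVar (a b : ℕ) (α : ℝ) (red : ℕ → Fin N → Set Ω) (t : ℕ) (ω : Ω) : ℝ :=
  (1 / (N : ℝ)) ^ 2 * ∑ i, redProb a b α red t i ω * (1 - redProb a b α red t i ω)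

variable [mΩ : MeasurableSpace Ω]

/-- The filtration of the histories. -/
def historyFiltration (red : ℕ → Fin N → Set Ω) (hred : ∀ t i, MeasurableSet (red t i)) :
    Filtration ℕ mΩ where
  seq := history red
  mono' _ _ hst := MeasurableSpace.generateFrom_mono fun _ ⟨k, hk, i, hs⟩ =>
    ⟨k, hk.trans_le hst, i, hs⟩
  le' _ := MeasurableSpace.generateFrom_le fun _ ⟨k, _, i, hs⟩ => hs ▸ hred k i

section Adapted

omit mΩ

variable {a b : ℕ} {α : ℝ} (red : ℕ → Fin N → Set Ω)

lemma measurable_frac (t : ℕ) (j : Fin N) : Measurable[history red t] (frac a b red t j) := by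
  have h : ∀ k ∈ Finset.range t,
      Measurable[history red t] fun ω => (red k j).indicator (fun _ => (1 : ℝ)) ω := fun k hk =>
    measurable_const.indicator
      (MeasurableSpace.measurableSet_generateFrom ⟨k, Finset.mem_range.1 hk, j, rfl⟩)
  exact ((Finset.measurable_fun_sum (Finset.range t) h).const_add _).div_const _

lemma measurable_total (t : ℕ) : Measurable[history red t] (total a b red t) :=
  (Finset.measurable_fun_sum Finset.univ fun i _ => measurable_frac red t i).const_mul _

lemma measurable_redProb (t : ℕ) (j : Fin N) :
    Measurable[history red t] (redProb a b α red t j) :=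
  ((measurable_total red t).const_mul _).add ((measurable_frac red t j).const_mul _)

lemma measurable_condVar (t : ℕ) : Measurable[history red t] (condVar a b α red t) :=
  (Finset.measurable_fun_sum Finset.univ fun i _ => (measurable_redProb red t i).mul
    ((measurable_redProb red t i).const_sub 1)).const_mul _

end Adapted

namespace IsMeanField

variable {μ : Measure Ω} [IsProbabilityMeasure μ] {a b : ℕ} {α : ℝ} {red : ℕ → Fin N → Set Ω}
  (h : IsMeanField μ a b α red)

include h

omit [IsProbabilityMeasure μ] in
lemma history_le (t : ℕ) : history red t ≤ mΩ :=
  (historyFiltration red h.measurableSet_red).le t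

lemma integrable_indicator (t : ℕ) (i : Fin N) :
    Integrable ((red t i).indicator fun _ => (1 : ℝ)) μ :=
  (integrable_const _).indicator (h.measurableSet_red t i)

omit [IsProbabilityMeasure μ] in
-- Conditional independence enters the argument through pairs of urns only, to remove the
-- covariances.
lemma condExp_mul_of_ne (t : ℕ) {i j : Fin N} (hij : i ≠ j) :
    μ[fun ω => (red t i).indicator (fun _ => (1 : ℝ)) ω *
      (red t j).indicator (fun _ => (1 : ℝ)) ω | history red t] =ᵐ[μ]
      fun ω => redProb a b α red t i ω * redProb a b α red t j ω := by
  have e : (fun ω => (red t i).indicator (fun _ => (1 : ℝ)) ω *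
      (red t j).indicator (fun _ => (1 : ℝ)) ω) =
      (⋂ k ∈ ({i, j} : Finset (Fin N)), red t k).indicator fun _ => (1 : ℝ) := by
    funext ω
    by_cases h1 : ω ∈ red t i <;> by_cases h2 : ω ∈ red t j <;> simp [h1, h2]
  rw [e]
  filter_upwards [h.condIndep_red t {i, j}, h.condProb_red t i, h.condProb_red t j] with ω h1 h2 h3
  rw [h1, Finset.prod_pair hij, h2, h3]
  rfl

omit [IsProbabilityMeasure μ] in
lemma condExp_mul_self (t : ℕ) (i : Fin N) :
    μ[fun ω => (red t i).indicator (fun _ => (1 : ℝ)) ω *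
      (red t i).indicator (fun _ => (1 : ℝ)) ω | history red t] =ᵐ[μ] redProb a b α red t i := by
  have e : (fun ω => (red t i).indicator (fun _ => (1 : ℝ)) ω *
      (red t i).indicator (fun _ => (1 : ℝ)) ω) = (red t i).indicator fun _ => (1 : ℝ) := by
    funext ω
    by_cases h1 : ω ∈ red t i <;> simp [h1]
  rw [e]
  exact h.condProb_red t i

lemma condExp_average (hN : 1 < N) (t : ℕ) :
    μ[fun ω => (1 / (N : ℝ)) * ∑ i, (red t i).indicator (fun _ => (1 : ℝ)) ω | history red t]
      =ᵐ[μ] total a b red t := by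
  have h1 : μ[fun ω => (1 / (N : ℝ)) * ∑ i, (red t i).indicator (fun _ => (1 : ℝ)) ω |
      history red t] =ᵐ[μ] (1 / (N : ℝ)) •
        μ[fun ω => ∑ i, (red t i).indicator (fun _ => (1 : ℝ)) ω | history red t] :=
    condExp_smul (1 / (N : ℝ)) (fun ω => ∑ i, (red t i).indicator (fun _ => (1 : ℝ)) ω)
      (history red t)
  have e : (fun ω => ∑ i, (red t i).indicator (fun _ => (1 : ℝ)) ω) =
      ∑ i, (red t i).indicator (fun _ => (1 : ℝ)) := by
    funext ω; rw [Finset.sum_apply]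
  rw [e] at h1
  filter_upwards [h1, condExp_finsetSum (s := Finset.univ)
    (fun i _ => h.integrable_indicator t i) (history red t),
    ae_all_iff.2 fun i => h.condProb_red t i] with ω h1 h2 h3
  rw [h1, Pi.smul_apply, h2, Finset.sum_apply, smul_eq_mul]
  simp_rw [h3]
  exact sum_redProb red hN t ω

lemma integrable_average (t : ℕ) :
    Integrable (fun ω => (1 / (N : ℝ)) * ∑ i, (red t i).indicator (fun _ => (1 : ℝ)) ω) μ :=
  (integrable_finsetSum _ fun i _ => h.integrable_indicator t i).const_mul _

lemma condExp_total_increment (hN : 1 < N) (ha : 1 ≤ a) (t : ℕ) :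
    μ[fun ω => total a b red (t + 1) ω - total a b red t ω | history red t] =ᵐ[μ] fun _ => 0 := by
  set A : Ω → ℝ := fun ω => (1 / (N : ℝ)) * ∑ i, (red t i).indicator (fun _ => (1 : ℝ)) ω with hA
  have hti : Integrable (total a b red t) μ := integrable_of_forall_abs_le
    ((measurable_total red t).mono (h.history_le t) le_rfl) (C := 1) fun ω => by
      rw [abs_of_nonneg (total_mem_Icc red hN ha t ω).1]; exact (total_mem_Icc red hN ha t ω).2
  have e : (fun ω => total a b red (t + 1) ω - total a b red t ω) =
      (1 / ((a : ℝ) + b + t + 1)) • (A - total a b red t) := by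
    funext ω
    rw [total_succ red ha, Pi.smul_apply, Pi.sub_apply, smul_eq_mul]
    ring
  rw [e]
  have h3 : μ[total a b red t | history red t] = total a b red t :=
    condExp_of_stronglyMeasurable (h.history_le t) (measurable_total red t).stronglyMeasurable hti
  filter_upwards [condExp_smul (μ := μ) (1 / ((a : ℝ) + b + t + 1)) (A - total a b red t)
    (history red t), condExp_sub (h.integrable_average t) hti (history red t),
    h.condExp_average hN t] with ω h1 h2 h4
  rw [h1, Pi.smul_apply, h2, Pi.sub_apply, h3, h4]
  simp

lemma condExp_total_increment_sq (hN : 1 < N) (ha : 1 ≤ a) (hα0 : 0 < α) (hα1 : α ≤ 1) (t : ℕ) :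
    μ[fun ω => (total a b red (t + 1) ω - total a b red t ω) ^ 2 | history red t] =ᵐ[μ]
      fun ω => condVar a b α red t ω / ((a : ℝ) + b + t + 1) ^ 2 := by
  set X : Fin N → Ω → ℝ := fun i ω =>
    (red t i).indicator (fun _ => (1 : ℝ)) ω - redProb a b α red t i ω with hX
  have hp := redProb_mem_Icc (b := b) red hN ha hα0 hα1 t
  have hp1 : ∀ i ω, |redProb a b α red t i ω| ≤ 1 := fun i ω => by
    rw [abs_of_nonneg (hp i ω).1]; exact (hp i ω).2
  have hIm : ∀ i, Measurable ((red t i).indicator fun _ => (1 : ℝ)) := fun i =>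
    measurable_const.indicator (h.measurableSet_red t i)
  have hXm : ∀ i, Measurable (X i) := fun i =>
    (hIm i).sub ((measurable_redProb red t i).mono (h.history_le t) le_rfl)
  have hX1 : ∀ i ω, |X i ω| ≤ 1 := fun i ω => by
    have h1 := indicator_one_mem_Icc (red t i) ω
    have h2 := hp i ω
    rw [abs_le]
    constructor <;> linarith [h1.1, h1.2, h2.1, h2.2]
  have hXX : ∀ i j, Integrable (fun ω => X i ω * X j ω) μ := fun i j =>
    integrable_of_forall_abs_le ((hXm i).mul (hXm j)) (C := 1) fun ω => by
      rw [abs_mul]; exact mul_le_one₀ (hX1 i ω) (abs_nonneg _) (hX1 j ω)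
  have hII : ∀ i j, Integrable (fun ω => (red t i).indicator (fun _ => (1 : ℝ)) ω *
      (red t j).indicator (fun _ => (1 : ℝ)) ω) μ := fun i j =>
    integrable_of_forall_abs_le ((hIm i).mul (hIm j)) (C := 1) fun ω => by
      have h1 := indicator_one_mem_Icc (red t i) ω
      have h2 := indicator_one_mem_Icc (red t j) ω
      rw [abs_mul, abs_of_nonneg h1.1, abs_of_nonneg h2.1]
      exact mul_le_one₀ h1.2 h2.1 h2.2
  have hcov : ∀ i j r, μ[fun ω => (red t i).indicator (fun _ => (1 : ℝ)) ω *
      (red t j).indicator (fun _ => (1 : ℝ)) ω | history red t] =ᵐ[μ] r →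
      μ[fun ω => X i ω * X j ω | history red t] =ᵐ[μ]
        fun ω => r ω - redProb a b α red t i ω * redProb a b α red t j ω := fun i j r hr =>
    condExp_mul_sub_sub_ae_eq (h.history_le t) (h.integrable_indicator t i)
      (h.integrable_indicator t j) (hII i j) (measurable_redProb red t i)
      (measurable_redProb red t j) (hp1 i) (hp1 j) (h.condProb_red t i) (h.condProb_red t j) hr
  have hsum := condExp_sum_sq_ae_eq (μ := μ) (m := history red t) hXX
    (fun i => hcov i i _ (h.condExp_mul_self t i)) fun i j hij => by
      simpa using hcov i j _ (h.condExp_mul_of_ne t hij)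
  have e : (fun ω => (total a b red (t + 1) ω - total a b red t ω) ^ 2) =
      ((1 / (N : ℝ)) ^ 2 / ((a : ℝ) + b + t + 1) ^ 2) • fun ω => (∑ i, X i ω) ^ 2 := by
    funext ω
    rw [total_succ red ha, Pi.smul_apply, smul_eq_mul, add_sub_cancel_left,
      ← sum_redProb (a := a) (b := b) (α := α) red hN, ← mul_sub, ← Finset.sum_sub_distrib, div_pow,
      mul_pow]
    simp only [hX]
    ring
  rw [e]
  filter_upwards [condExp_smul (μ := μ) ((1 / (N : ℝ)) ^ 2 / ((a : ℝ) + b + t + 1) ^ 2)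
    (fun ω => (∑ i, X i ω) ^ 2) (history red t), hsum] with ω h1 h2
  rw [h1, Pi.smul_apply, h2, smul_eq_mul, condVar]
  have h3 : ∀ x : ℝ, x - x * x = x * (1 - x) := fun x => by ring
  simp_rw [h3]
  ring

lemma isSlowMartingale (hN : 1 < N) (ha : 1 ≤ a) (hα0 : 0 < α) (hα1 : α ≤ 1) :
    IsSlowMartingale μ (historyFiltration red h.measurableSet_red) (total a b red)
      (condVar a b α red) ((a : ℝ) + b) where
  one_le := by
    have ha' : (1 : ℝ) ≤ a := by exact_mod_cast ha
    have hb : (0 : ℝ) ≤ b := b.cast_nonneg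
    linarith
  measurable_left := measurable_total red
  measurable_right := measurable_condVar red
  left_mem_Icc := total_mem_Icc red hN ha
  right_mem_Icc t ω := by
    have hp := fun i => redProb_mem_Icc (b := b) red hN ha hα0 hα1 t i ω
    have hN1 : (1 : ℝ) ≤ N := by exact_mod_cast hN.le
    have h1 := average_mem_Icc hN (x := fun i =>
      redProb a b α red t i ω * (1 - redProb a b α red t i ω)) fun i =>
        ⟨mul_nonneg (hp i).1 (by linarith [(hp i).2]),
          mul_le_one₀ (hp i).2 (by linarith [(hp i).2]) (by linarith [(hp i).1])⟩
    have h2 : 1 / (N : ℝ) ≤ 1 := (div_le_one (by linarith)).2 hN1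
    have h3 : (0 : ℝ) ≤ 1 / N := by positivity
    rw [condVar, sq, mul_assoc]
    exact ⟨mul_nonneg h3 h1.1, mul_le_one₀ h2 h1.1 h1.2⟩
  abs_increment_le t ω := by
    have h1 := average_mem_Icc hN fun i => indicator_one_mem_Icc (red t i) ω
    have h2 := total_mem_Icc (b := b) red hN ha t ω
    have h3 : (0 : ℝ) ≤ (a : ℝ) + b + t + 1 := by positivity
    rw [total_succ red ha, add_sub_cancel_left, abs_div, abs_of_nonneg h3]
    refine div_le_div_of_nonneg_right (abs_le.2 ?_) h3
    constructor <;> linarith [h1.1, h1.2, h2.1, h2.2]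
  condExp_increment := h.condExp_total_increment hN ha
  condExp_increment_sq := h.condExp_total_increment_sq hN ha hα0 hα1

/-- Synchronization: the proportion of red balls in each urn approaches the total proportion. -/
lemma tendsto_frac_sub_total (hN : 1 < N) (ha : 1 ≤ a) (hα0 : 0 < α) (j : Fin N) :
    ∀ᵐ ω ∂μ, Tendsto (fun t => frac a b red t j ω - total a b red t ω) atTop (𝓝 0) := by
  set D : ℕ → Ω → ℝ := fun t ω => frac a b red t j ω - total a b red t ω with hD
  have hDm : ∀ t, Measurable[history red t] (D t) := fun t =>
    (measurable_frac red t j).sub (measurable_total red t)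
  have hD1 : ∀ t ω, |D t ω| ≤ 1 := fun t ω => by
    have h1 := frac_mem_Icc (b := b) red ha t j ω
    have h2 := total_mem_Icc (b := b) red hN ha t ω
    rw [abs_le]
    constructor <;> linarith [h1.1, h1.2, h2.1, h2.2]
  have hm0 : ∀ t, Measurable (D t) := fun t => (hDm t).mono (h.history_le t) le_rfl
  have hQ : ∀ t ω, D t ω ^ 2 ∈ Set.Icc (0 : ℝ) 1 := fun t ω => by
    refine ⟨sq_nonneg _, ?_⟩
    rw [← sq_abs]
    exact pow_le_one₀ (abs_nonneg _) (hD1 t ω)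
  have hQi : ∀ t, Integrable (fun ω => D t ω ^ 2) μ := fun t =>
    integrable_of_forall_abs_le ((hm0 t).pow_const 2) (C := 1) fun ω => by
      rw [abs_of_nonneg (hQ t ω).1]; exact (hQ t ω).2
  -- The gap `D` has conditional drift `-α D / c`, so its square contracts at rate `2 * α`; the
  -- constant `4` bounds the square of the rescaled increment `η`, for which `|η| ≤ 2`.
  have key := tendsto_zero_of_condExp_succ_le (μ := μ) (historyFiltration red h.measurableSet_red)
    (Q := fun t ω => D t ω ^ 2) (fun t => (hDm t).pow_const 2) hQ (c := a + b) (by omega)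
    (β := 2 * α) (C := 4) (by positivity) (by norm_num) fun t => ?_
  · filter_upwards [key] with ω hω
    have h1 := (Real.continuous_sqrt.tendsto 0).comp hω
    rw [Real.sqrt_zero] at h1
    refine (tendsto_zero_iff_abs_tendsto_zero _).2 (h1.congr fun t => ?_)
    exact Real.sqrt_sq_eq_abs _
  push_cast
  change μ[fun ω => D (t + 1) ω ^ 2 | history red t] ≤ᵐ[μ] _
  have ha' : (1 : ℝ) ≤ a := by exact_mod_cast ha
  set c : ℝ := (a : ℝ) + b + t + 1 with hc
  have hc0 : 0 < c := by positivity
  set I : Ω → ℝ := (red t j).indicator (fun _ => (1 : ℝ)) with hI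
  set A : Ω → ℝ := fun ω => (1 / (N : ℝ)) * ∑ i, (red t i).indicator (fun _ => (1 : ℝ)) ω with hA
  have hIi : Integrable I μ := h.integrable_indicator t j
  have hAi : Integrable A μ := h.integrable_average t
  have hDi : Integrable (D t) μ := integrable_of_forall_abs_le (hm0 t) (hD1 t)
  have hsucc : ∀ ω, D (t + 1) ω = D t ω + (I ω - A ω - D t ω) / c := fun ω => by
    simp only [hD, hI, hA, hc]
    rw [frac_succ red ha, total_succ red ha]
    ring
  set η : Ω → ℝ := (I - A) - D t with hη
  have hηi : Integrable η μ := (hIi.sub hAi).sub hDi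
  have hDη : Integrable (D t * η) μ :=
    hηi.bdd_mul (hm0 t).aestronglyMeasurable (ae_of_all _ (hD1 t))
  have hpt : ∀ ω, D (t + 1) ω ^ 2 ≤
      ((fun ω => D t ω ^ 2 + 4 / c ^ 2 : Ω → ℝ) + (2 / c) • (D t * η) : Ω → ℝ) ω := fun ω => by
    have h1 := indicator_one_mem_Icc (red t j) ω
    have h2 := average_mem_Icc hN fun i => indicator_one_mem_Icc (red t i) ω
    have h3 := abs_le.1 (hD1 t ω)
    have h4 : |η ω| ≤ 2 := by
      simp only [hη, Pi.sub_apply]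
      rw [abs_le]
      constructor <;> linarith [h1.1, h1.2, h2.1, h2.2, h3.1, h3.2]
    have h5 : η ω ^ 2 ≤ 4 := by
      rw [← sq_abs]; nlinarith [abs_nonneg (η ω)]
    have h6 : D (t + 1) ω = D t ω + η ω / c := hsucc ω
    rw [h6]
    simp only [Pi.add_apply, Pi.smul_apply, Pi.mul_apply, smul_eq_mul]
    have h7 : η ω ^ 2 / c ^ 2 ≤ 4 / c ^ 2 := by gcongr
    have h8 : (D t ω + η ω / c) ^ 2 = D t ω ^ 2 + 2 / c * (D t ω * η ω) + η ω ^ 2 / c ^ 2 := by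
      field_simp
      ring
    linarith
  have hci : Integrable (fun ω => D t ω ^ 2 + 4 / c ^ 2) μ := (hQi t).add (integrable_const _)
  have hcm : μ[fun ω => D t ω ^ 2 + 4 / c ^ 2 | history red t] = fun ω => D t ω ^ 2 + 4 / c ^ 2 :=
    condExp_of_stronglyMeasurable (h.history_le t)
      (((hDm t).pow_const 2).add_const _).stronglyMeasurable hci
  have hDc : μ[D t | history red t] = D t :=
    condExp_of_stronglyMeasurable (h.history_le t) (hDm t).stronglyMeasurable hDi
  filter_upwards [condExp_mono (m := history red t) (hQi (t + 1)) (hci.add (hDη.smul (2 / c)))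
      (ae_of_all _ hpt), condExp_add hci (hDη.smul (2 / c)) (history red t),
    condExp_smul (μ := μ) (2 / c) (D t * η) (history red t),
    condExp_mul_of_stronglyMeasurable_left (hDm t).stronglyMeasurable hDη hηi,
    condExp_sub (hIi.sub hAi) hDi (history red t), condExp_sub hIi hAi (history red t),
    h.condProb_red t j, h.condExp_average hN t] with ω h1 h2 h3 h4 h5 h6 h7 h8
  rw [h2, Pi.add_apply, hcm, h3, Pi.smul_apply, h4, Pi.mul_apply, h5, Pi.sub_apply, h6,
    Pi.sub_apply, hDc, h7, h8, smul_eq_mul] at h1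
  refine h1.trans_eq ?_
  simp only [hD]
  field_simp
  ring

lemma tendsto_condVar (hN : 1 < N) (ha : 1 ≤ a) (hα0 : 0 < α) {Z : Ω → ℝ}
    (hZ : ∀ᵐ ω ∂μ, Tendsto (fun t => total a b red t ω) atTop (𝓝 (Z ω))) :
    ∀ᵐ ω ∂μ, Tendsto (fun t => condVar a b α red t ω) atTop
      (𝓝 ((1 / (N : ℝ)) * (Z ω - Z ω ^ 2))) := by
  have hN0 : (N : ℝ) ≠ 0 := by exact_mod_cast (by omega : N ≠ 0)
  filter_upwards [hZ, ae_all_iff.2 fun j => h.tendsto_frac_sub_total hN ha hα0 j] with ω hZ hD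
  have hp : ∀ i, Tendsto (fun t => redProb a b α red t i ω) atTop (𝓝 (Z ω)) := fun i => by
    have h1 := hZ.add ((hD i).const_mul (1 - α))
    rw [mul_zero, add_zero] at h1
    refine h1.congr fun t => ?_
    unfold redProb
    ring
  have h2 := (tendsto_finsetSum Finset.univ fun i _ =>
    (hp i).mul ((hp i).const_sub 1)).const_mul ((1 / (N : ℝ)) ^ 2)
  rw [Finset.sum_const, Finset.card_univ, Fintype.card_fin, nsmul_eq_mul] at h2
  have e : (1 / (N : ℝ)) ^ 2 * (N * (Z ω * (1 - Z ω))) = (1 / (N : ℝ)) * (Z ω - Z ω ^ 2) := by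
    field_simp
  rwa [e] at h2

end IsMeanField

end PolyaUrns

/-- The limit is determined only up to a null set, so the two modes of convergence are stated for
every measurable choice of it. -/
theorem theorem1 {Ω : Type*} [MeasurableSpace Ω] (μ : Measure Ω) [IsProbabilityMeasure μ]
    (N : ℕ) (hN : 1 < N) (a b : ℕ) (ha : 1 ≤ a) (hb : 1 ≤ b)
    (α : ℝ) (hα0 : 0 < α) (hα1 : α ≤ 1)
    (red : ℕ → Fin N → Set Ω) (hred : PolyaUrns.IsMeanField μ a b α red) :
    (∃ Z : Ω → ℝ, Measurable Z ∧
      ∀ᵐ ω ∂μ, Tendsto (fun t => PolyaUrns.total a b red t ω) atTop (𝓝 (Z ω))) ∧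
    ∀ (Z : Ω → ℝ) (hZ : Measurable Z),
      (∀ᵐ ω ∂μ, Tendsto (fun t => PolyaUrns.total a b red t ω) atTop (𝓝 (Z ω))) →
      StablyConverges μ
        (fun (t : ℕ) ω => √(t : ℝ) * (PolyaUrns.total a b red t ω - Z ω))
        (gaussianKernel (fun ω => (1 / (N : ℝ)) * (Z ω - Z ω ^ 2))
          ((hZ.sub (hZ.pow_const 2)).const_mul (1 / (N : ℝ)))) ∧
      ASConditionallyConverges μ (PolyaUrns.history red)
        (fun (t : ℕ) ω => √(t : ℝ) * (PolyaUrns.total a b red t ω - Z ω))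
        (gaussianKernel (fun ω => (1 / (N : ℝ)) * (Z ω - Z ω ^ 2))
          ((hZ.sub (hZ.pow_const 2)).const_mul (1 / (N : ℝ)))) := by
  have hM := hred.isSlowMartingale hN ha hα0 hα1
  refine ⟨hM.exists_ae_tendsto, fun Z hZ hMZ => ?_⟩
  have hV := hred.tendsto_condVar hN ha hα0 hMZ
  exact ⟨hM.stablyConverges _ hZ hMZ hV, hM.asConditionallyConverges _ hZ hMZ hV⟩
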